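/- Let $\rho_1,\rho_2$ be density operators on $\mathbb C^2$ with prior probabilities $q_1,q_2\ge 0$, $q_1+q_2=1$, such that $\rho_0=q_1\rho_1+q_2\rho_2$ has full rank. For $q>0$ the modified three-state problem is to maximize $q\,\mathrm{tr}[\rho_0M_0]+q_1\mathrm{tr}[\rho_1M_1]+q_2\mathrm{tr}[\rho_2M_2]$ over all POVMs $\{M_0,M_1,M_2\}$ ($M_i\ge 0$, $\sum_iM_i=I$). Let $\bar P^{\rm opt}_{\rm cor}(q)$ be the maximum, call a POVM attaining it optimal, and let $P_{\rm I}(q)$ be the set of all $\mathrm{tr}[\rho_0M_0]$ with $\{M_i\}$ optimal. Put $$q_0^{(0)}=\max\{q>0:0\in P_{\rm I}(q)\},\qquad q_0^{(1)}=\min\{q>0:1\in P_{\rm I}(q)\}.$$ Let $\bar\rho_i=\rho_0^{-1/2}q_i\rho_i\rho_0^{-1/2}$ for $i=1,2$, let $C_i$ be the largest eigenvalue of $\bar\rho_i$ and $|\nu_i\rangle$ a corresponding unit eigenvector, and assume (without loss of generality) $C_1\le C_2$. Put $\rho_{ij}=\langle\nu_i|\rho_0|\nu_j\rangle$ and $\bar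 M_i=\rho_0^{1/2}M_i\rho_0^{1/2}$. Let $\sigma=(\sigma_x,\sigma_y,\sigma_z)$ be the Pauli matrices and $v_i\in\mathbb R^3$ the Bloch vector of $\rho_i$, i.e. $\rho_i=\frac12(I+v_i\cdot\sigma)$, and write $d_i=qv_0-q_iv_i$. Put $$\lambda_1=\frac{(2C_2-1)(C_1-q)(q-1+C_1)}{(2q-1)(C_1+C_2-1)},\qquad \lambda_2=\frac{(2C_1-1)(C_2-q)(q-1+C_2)}{(2q-1)(C_1+C_2-1)},$$ $$R=\sqrt{(2C_1-1)(2C_2-1)(C_1-q)(C_2-q)(q-1+C_1)(q-1+C_2)},$$ $$\eta_0=\frac{(2C_1-1)(2C_2-1)-(2q-1)^2}{2(2q-1)^2(C_1+C_2-1)}\Big[1-2\rho_{11}C_1-2\rho_{22}C_2+\tfrac{|\rho_{12}|(2C_1-1)(2C_2-1)[(C_1-q)(C_2-q)+(q-1+C_1)(q-1+C_2)]}{R}\Big],$$ $$\eta_1=\frac{(2C_1-1)(2C_2-1)+2(C_2-C_1)(2q-1)+(2q-1)^2}{2(2q-1)^2(C_1+C_2-1)}\Big[\rho_{11}(q-1+C_1)+\rho_{22}(C_2-q)-\tfrac{|\rho_{12}|(C_2-q)(q-1+C_1)[(2C_1-1)(q-1+C_2)+(2C_2-1)(C_1-q)]}{R}\Big],$$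 $$\eta_2=\frac{(2C_1-1)(2C_2-1)-2(C_2-C_1)(2q-1)+(2q-1)^2}{2(2q-1)^2(C_1+C_2-1)}\Big[\rho_{11}(C_1-q)+\rho_{22}(q-1+C_2)-\tfrac{|\rho_{12}|(C_1-q)(q-1+C_2)[(2C_2-1)(q-1+C_1)+(2C_1-1)(C_2-q)]}{R}\Big].$$ **Theorem.** Suppose $\rho_{12}\ne 0$ and $q_0^{(0)}<q<q_0^{(1)}$. Then there is exactly one optimal POVM $\{M_0,M_1,M_2\}$, and at least one of $M_1,M_2$ is nonzero. Moreover: 1. If $M_x\ne 0$ and $M_y=0$ with $\{x,y\}=\{1,2\}$, then $x$ is the (unique) index $i\in\{1,2\}$ maximizing $q_i+\|d_i\|$, and $$\bar P^{\rm opt}_{\rm cor}(q)=\tfrac12\big(q+q_x+\|d_x\|\big),\qquad P_{\rm I}(q)=\Big\{\tfrac12\Big[1+\frac{d_x\cdot v_0}{\|d_x\|}\Big]\Big\},$$ $$M_0=\tfrac12\Big[I+\frac{d_x\cdot\sigma}{\|d_x\|}\Big],\qquad M_x=\tfrac12\Big[I-\frac{d_x\cdot\sigma}{\|d_x\|}\Big].$$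 2. If $M_0,M_1,M_2$ are all nonzero, then $$\bar P^{\rm opt}_{\rm cor}(q)=q+\rho_{11}\lambda_1+\rho_{22}\lambda_2-2|\rho_{12}|\sqrt{\lambda_1\lambda_2},\qquad P_{\rm I}(q)=\{\eta_0\},$$ and, with $\omega=\frac{\rho_{12}}{|\rho_{12}|}\sqrt{\lambda_1\lambda_2}$, $\omega'=\frac{\rho_{21}}{|\rho_{21}|}\sqrt{\lambda_1\lambda_2}$ and $X=\omega|\nu_1\rangle\langle\nu_2|+\omega'|\nu_2\rangle\langle\nu_1|$, $$\bar M_0=\frac{\eta_0}{\lambda_1+\lambda_2}\big[\lambda_2|\nu_1\rangle\langle\nu_1|+X+\lambda_1|\nu_2\rangle\langle\nu_2|\big],$$ $$\bar M_1=\frac{\eta_1}{\lambda_1+\lambda_2+2q-1-C_1+C_2}\big[(\lambda_2+q-1+C_2)|\nu_1\rangle\langle\nu_1|+X+(\lambda_1+q-C_1)|\nu_2\rangle\langle\nu_2|\big],$$ $$\bar M_2=\frac{\eta_2}{\lambda_1+\lambda_2+2q-1+C_1-C_2}\big[(\lambda_2+q-C_2)|\nu_1\rangle\langle\nu_1|+X+(\lambda_1+q-1+C_1)|\nu_2\rangle\langle\nu_2|\big].$$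 3. If $\lambda_1,\lambda_2\ge 0$ and $\eta_0,\eta_1,\eta_2>0$, then $M_0,M_1,M_2$ are all nonzero. Otherwise $M_1=0$ or $M_2=0$. (If $\lambda_1\lambda_2=0$, the terms divided by $R=0$ are read as $0$; the condition then fails.) -/

import Mathlib

open scoped MatrixOrder ComplexOrder
open Matrix

/-- Linear operators on the qubit Hilbert space `ℂ²`. -/
abbrev QubitOp : Type := Matrix (Fin 2) (Fin 2) ℂ

/-- An ensemble `{q₁, ρ₁; q₂, ρ₂}` of two qubit states (density operators) with prior
probabilities, whose average state `q₁ρ₁ + q₂ρ₂` has full rank. -/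
structure QubitEnsemble where
  q₁ : ℝ
  q₂ : ℝ
  ρ₁ : QubitOp
  ρ₂ : QubitOp
  q₁_nonneg : 0 ≤ q₁
  q₂_nonneg : 0 ≤ q₂
  q_sum : q₁ + q₂ = 1
  ρ₁_psd : ρ₁.PosSemidef
  ρ₂_psd : ρ₂.PosSemidef
  ρ₁_trace : ρ₁.trace = 1
  ρ₂_trace : ρ₂.trace = 1
  avg_full : ((q₁ : ℂ) • ρ₁ + (q₂ : ℂ) • ρ₂).PosDef

namespace QubitEnsemble

/-- The average state `ρ₀ = q₁ρ₁ + q₂ρ₂`. -/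
def ρ₀ (E : QubitEnsemble) : QubitOp := (E.q₁ : ℂ) • E.ρ₁ + (E.q₂ : ℂ) • E.ρ₂

/-- The three states `ρ₀, ρ₁, ρ₂`. -/
def state (E : QubitEnsemble) : Fin 3 → QubitOp := ![E.ρ₀, E.ρ₁, E.ρ₂]

/-- The three weights `q, q₁, q₂`, where `q` is the inconclusive degree. -/
def weight (E : QubitEnsemble) (q : ℝ) : Fin 3 → ℝ := ![q, E.q₁, E.q₂]

end QubitEnsemble

/-- Three-outcome POVMs `{M₀, M₁, M₂}` on a qubit. -/
def IsPOVM (M : Fin 3 → QubitOp) : Prop := (∀ i, (M i).PosSemidef) ∧ ∑ i, M i = 1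

namespace QubitEnsemble

/-- The objective `q tr[ρ₀M₀] + q₁ tr[ρ₁M₁] + q₂ tr[ρ₂M₂]` of the modified problem. -/
noncomputable def pbarCor (E : QubitEnsemble) (q : ℝ) (M : Fin 3 → QubitOp) : ℝ :=
  ∑ i, E.weight q i * ((E.state i * M i).trace).re

/-- The optimal value of the modified problem with inconclusive degree `q`. -/
noncomputable def pbarOpt (E : QubitEnsemble) (q : ℝ) : ℝ :=
  sSup (E.pbarCor q '' {M | IsPOVM M})

/-- `M` is an optimal POVM of the modified problem with inconclusive degree `q`. -/
def IsOptimal (E : QubitEnsemble) (q : ℝ) (M : Fin 3 → QubitOp) : Prop :=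
  IsPOVM M ∧ E.pbarCor q M = E.pbarOpt q

/-- The set `P_I(q)` of the values `tr[ρ₀M₀]` attained by the optimal POVMs. -/
def PI (E : QubitEnsemble) (q : ℝ) : Set ℝ :=
  {Q | ∃ M, E.IsOptimal q M ∧ ((E.ρ₀ * M 0).trace).re = Q}

/-- The special inconclusive degree `q₀⁽⁰⁾ = max {q > 0 : 0 ∈ P_I(q)}`. -/
noncomputable def qLow (E : QubitEnsemble) : ℝ := sSup {q | 0 < q ∧ (0 : ℝ) ∈ E.PI q}

/-- The special inconclusive degree `q₀⁽¹⁾ = min {q > 0 : 1 ∈ P_I(q)}`. -/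
noncomputable def qHigh (E : QubitEnsemble) : ℝ := sInf {q | 0 < q ∧ (1 : ℝ) ∈ E.PI q}

/-- `ρ₀^{1/2}`. -/
noncomputable def rootAvg (E : QubitEnsemble) : QubitOp := CFC.sqrt E.ρ₀

/-- `ρ̄₁ = ρ₀^{-1/2} q₁ρ₁ ρ₀^{-1/2}`. -/
noncomputable def barState₁ (E : QubitEnsemble) : QubitOp :=
  E.rootAvg⁻¹ * ((E.q₁ : ℂ) • E.ρ₁) * E.rootAvg⁻¹

/-- `ρ̄₂ = ρ₀^{-1/2} q₂ρ₂ ρ₀^{-1/2}`. -/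
noncomputable def barState₂ (E : QubitEnsemble) : QubitOp :=
  E.rootAvg⁻¹ * ((E.q₂ : ℂ) • E.ρ₂) * E.rootAvg⁻¹

/-- The maximum confidence `C₁`: the largest eigenvalue of `ρ̄₁`. -/
noncomputable def C₁ (E : QubitEnsemble) : ℝ := sSup (spectrum ℝ E.barState₁)

/-- The maximum confidence `C₂`: the largest eigenvalue of `ρ̄₂`. -/
noncomputable def C₂ (E : QubitEnsemble) : ℝ := sSup (spectrum ℝ E.barState₂)

/-- `M̄ = ρ₀^{1/2} M ρ₀^{1/2}`. -/
noncomputable def bar (E : QubitEnsemble) (M : QubitOp) : QubitOp :=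
  E.rootAvg * M * E.rootAvg

/-- The matrix element `⟨u|ρ₀|v⟩`. -/
def entry (E : QubitEnsemble) (u v : Fin 2 → ℂ) : ℂ := star u ⬝ᵥ (E.ρ₀ *ᵥ v)

end QubitEnsemble

/-- `ν` is a unit eigenvector of `A` for the eigenvalue `c`. -/
def IsUnitEigenvector (A : QubitOp) (c : ℝ) (ν : Fin 2 → ℂ) : Prop :=
  star ν ⬝ᵥ ν = 1 ∧ A *ᵥ ν = (c : ℂ) • ν

/-- `|u⟩⟨v|`. -/
def ketbra (u v : Fin 2 → ℂ) : QubitOp := vecMulVec u (star v)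

/-- The Pauli matrices `σ_x, σ_y, σ_z`. -/
def pauli : Fin 3 → QubitOp :=
  ![!![0, 1; 1, 0], !![0, -Complex.I; Complex.I, 0], !![1, 0; 0, -1]]

/-- The operator `n · σ`. -/
noncomputable def dotPauli (n : EuclideanSpace ℝ (Fin 3)) : QubitOp :=
  ∑ j, (n j : ℂ) • pauli j

/-- The Bloch vector of a density operator: the `v` with `ρ = (I + v · σ) / 2`. -/
noncomputable def bloch (ρ : QubitOp) : EuclideanSpace ℝ (Fin 3) :=
  WithLp.toLp 2 fun j => ((ρ * pauli j).trace).re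

/-- `q v₀ - q_i v_i`. -/
noncomputable def QubitEnsemble.blochDiff (E : QubitEnsemble) (q : ℝ) (i : Fin 3) :
    EuclideanSpace ℝ (Fin 3) :=
  q • bloch E.ρ₀ - E.weight q i • bloch (E.state i)

/-- `λ₁`, as a function of `q, C₁, C₂`. -/
noncomputable def lam₁ (q C₁ C₂ : ℝ) : ℝ :=
  ((2 * C₂ - 1) * (C₁ - q) * (q - 1 + C₁)) / ((2 * q - 1) * (C₁ + C₂ - 1))

/-- `λ₂`, as a function of `q, C₁, C₂`. -/
noncomputable def lam₂ (q C₁ C₂ : ℝ) : ℝ :=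
  ((2 * C₁ - 1) * (C₂ - q) * (q - 1 + C₂)) / ((2 * q - 1) * (C₁ + C₂ - 1))

/-- The square root in the denominators of `η₀, η₁, η₂`. -/
noncomputable def etaRoot (q C₁ C₂ : ℝ) : ℝ :=
  Real.sqrt ((2 * C₁ - 1) * (2 * C₂ - 1) * (C₁ - q) * (C₂ - q) * (q - 1 + C₁) * (q - 1 + C₂))

/-- `η₀`, as a function of `q, C₁, C₂`, `a = ρ₁₁`, `b = ρ₂₂` and `r = |ρ₁₂|`. -/
noncomputable def eta₀ (q C₁ C₂ a b r : ℝ) : ℝ :=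
  (((2 * C₁ - 1) * (2 * C₂ - 1) - (2 * q - 1) ^ 2)
      / (2 * (2 * q - 1) ^ 2 * (C₁ + C₂ - 1)))
    * (1 - 2 * a * C₁ - 2 * b * C₂
        + r * (2 * C₁ - 1) * (2 * C₂ - 1)
            * ((C₁ - q) * (C₂ - q) + (q - 1 + C₁) * (q - 1 + C₂)) / etaRoot q C₁ C₂)

/-- `η₁`, as a function of `q, C₁, C₂`, `a = ρ₁₁`, `b = ρ₂₂` and `r = |ρ₁₂|`. -/
noncomputable def eta₁ (q C₁ C₂ a b r : ℝ) : ℝ :=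
  (((2 * C₁ - 1) * (2 * C₂ - 1) + 2 * (C₂ - C₁) * (2 * q - 1) + (2 * q - 1) ^ 2)
      / (2 * (2 * q - 1) ^ 2 * (C₁ + C₂ - 1)))
    * (a * (q - 1 + C₁) + b * (C₂ - q)
        - r * (C₂ - q) * (q - 1 + C₁)
            * ((2 * C₁ - 1) * (q - 1 + C₂) + (2 * C₂ - 1) * (C₁ - q)) / etaRoot q C₁ C₂)

/-- `η₂`, as a function of `q, C₁, C₂`, `a = ρ₁₁`, `b = ρ₂₂` and `r = |ρ₁₂|`. -/
noncomputable def eta₂ (q C₁ C₂ a b r : ℝ) : ℝ :=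
  (((2 * C₁ - 1) * (2 * C₂ - 1) - 2 * (C₂ - C₁) * (2 * q - 1) + (2 * q - 1) ^ 2)
      / (2 * (2 * q - 1) ^ 2 * (C₁ + C₂ - 1)))
    * (a * (C₁ - q) + b * (q - 1 + C₂)
        - r * (C₁ - q) * (q - 1 + C₂)
            * ((2 * C₂ - 1) * (q - 1 + C₁) + (2 * C₁ - 1) * (C₂ - q)) / etaRoot q C₁ C₂)

/-- The operator `s (x |ν₁⟩⟨ν₁| + z |ν₁⟩⟨ν₂| + w |ν₂⟩⟨ν₁| + y |ν₂⟩⟨ν₂|)`. -/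
noncomputable def opInBasis (ν₁ ν₂ : Fin 2 → ℂ) (s x : ℝ) (z w : ℂ) (y : ℝ) : QubitOp :=
  (s : ℂ) • ((x : ℂ) • ketbra ν₁ ν₁ + z • ketbra ν₁ ν₂ + w • ketbra ν₂ ν₁
    + (y : ℂ) • ketbra ν₂ ν₂)

/-! The modified problem is a semidefinite program. A maximizer exists by compactness, and it has a
Lagrange operator `L` with `L - Aᵢ ≥ 0` and `(L - Aᵢ) Mᵢ = 0`, where the `Aᵢ` are the weighted
states (`exists_lagrange_of_max`). Any such `L` has trace equal to the optimum and is complementary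
to every optimal POVM, so a single `L` controls them all.

Since `ρ̄₁ + ρ̄₂ = 1`, both operators are diagonal in the basis `ν₁, ν₂`. A pair of congruences
(`IsFrame`) takes `qρ₀` to `q I` and the other two weighted states to diagonal matrices, and takes
the sum of the measurement operators to the Gram matrix `(ρᵢⱼ)`. The three slacks `L - Aᵢ` then
share one off-diagonal entry `w` and differ only by known diagonal shifts. As `ρ₁₂ ≠ 0`, `w` cannot
vanish, so each transformed `Mᵢ` is a multiple `mᵢ ≥ 0` of the adjugate of its slack. The
completeness relation is linear in the `mᵢ` with determinant `(2q-1)(C₁+C₂-1) ≠ 0`, which gives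
uniqueness (`IsFrame.unique`).

If all `Mᵢ` are nonzero, all three slacks are singular. Subtracting determinants gives a linear
system for the diagonal of `L - qρ₀`, whose solution is `λ₁, λ₂`; the modulus and phase of `w`
follow, then the `mᵢ`, and `ηᵢ = tr[ρ₀Mᵢ]` is `mᵢ` times the trace of the adjugate
(`IsFrame.of_forall_ne_zero`). Conversely, when the `mᵢ` so defined are positive and `q < C₁`, the
same formulas produce an `L` and a POVM that certify each other
(`IsFrame.exists_isOptimal_ne_zero`).

If one of `M₁, M₂` vanishes, what remains is a two-outcome problem, solved with Bloch vectors: the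
bound is piecewise linear in `tr M₀`, and its two ends are excluded by `0, 1 ∉ P_I(q)`
(`blochProj_isOptimal`). -/

/-! ### Duality for discrimination of three operators. -/

/-- The value `∑ i, tr[A i * M i]` of a measurement `M` for the operators `A`. -/
noncomputable def povmValue (A M : Fin 3 → QubitOp) : ℝ := ∑ i, ((A i * M i).trace).re

/-- With `A = X*X` and `M = Y*Y`, take `B = XY*`. This yields both the sign of `tr(AM)` and its
equality case. -/
lemma trace_mul_eq_conj_of_posSemidef {A M : QubitOp} (hA : A.PosSemidef) (hM : M.PosSemidef) :
    ∃ B : QubitOp, (A * M).trace = (Bᴴ * B).trace ∧ (B = 0 → A * M = 0) := by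
  obtain ⟨X, rfl⟩ := CStarAlgebra.nonneg_iff_eq_star_mul_self.mp hA.nonneg
  obtain ⟨Y, rfl⟩ := CStarAlgebra.nonneg_iff_eq_star_mul_self.mp hM.nonneg
  simp only [star_eq_conjTranspose]
  refine ⟨X * Yᴴ, ?_, fun h => ?_⟩
  · rw [conjTranspose_mul, conjTranspose_conjTranspose, ← Matrix.mul_assoc, Matrix.trace_mul_comm]
    simp only [Matrix.mul_assoc]
  · rw [Matrix.mul_assoc, ← Matrix.mul_assoc X, h]; simp

lemma trace_mul_nonneg {A M : QubitOp} (hA : A.PosSemidef) (hM : M.PosSemidef) :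
    0 ≤ (A * M).trace := by
  obtain ⟨B, hB, -⟩ := trace_mul_eq_conj_of_posSemidef hA hM
  rw [hB]; exact (posSemidef_conjTranspose_mul_self B).trace_nonneg

lemma trace_mul_re_nonneg {A M : QubitOp} (hA : A.PosSemidef) (hM : M.PosSemidef) :
    0 ≤ ((A * M).trace).re := (Complex.le_def.mp (trace_mul_nonneg hA hM)).1

lemma mul_eq_zero_of_trace_re_eq_zero {A M : QubitOp} (hA : A.PosSemidef) (hM : M.PosSemidef)
    (h : ((A * M).trace).re = 0) : A * M = 0 := by
  have h0 : (A * M).trace = 0 :=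
    Complex.ext h (Complex.le_def.mp (trace_mul_nonneg hA hM)).2.symm
  obtain ⟨B, hB, hB'⟩ := trace_mul_eq_conj_of_posSemidef hA hM
  exact hB' (trace_conjTranspose_mul_self_eq_zero_iff.mp (hB ▸ h0))

lemma isPOVM_entry_norm_le {M : Fin 3 → QubitOp} (hM : IsPOVM M) (i : Fin 3) (j k : Fin 2) :
    ‖M i j k‖ ≤ 1 := by
  have hle : ∀ j, M i j j ≤ 1 := fun j => by
    have h1 : ∑ i, M i j j = 1 := by
      have := congrFun (congrFun hM.2 j) j
      simpa [Matrix.sum_apply] using this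
    rw [← h1]
    exact Finset.single_le_sum (f := fun i => M i j j) (fun i _ => (hM.1 i).diag_nonneg)
      (Finset.mem_univ i)
  have hre : ∀ j, 0 ≤ (M i j j).re ∧ (M i j j).re ≤ 1 := fun j =>
    ⟨(Complex.le_def.mp (hM.1 i).diag_nonneg).1, (Complex.le_def.mp (hle j)).1⟩
  have him : ∀ j, (M i j j).im = 0 := fun j =>
    (Complex.le_def.mp (hM.1 i).diag_nonneg).2.symm
  have hh : ∀ j k, M i k j = star (M i j k) := fun j k => ((hM.1 i).isHermitian.apply k j).symm
  have hd := (hM.1 i).det_nonneg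
  rw [Matrix.det_fin_two, hh 0 1] at hd
  have hd1 := (Complex.le_def.mp hd).1
  simp only [Complex.sub_re, Complex.mul_re, him, Complex.star_def, Complex.conj_re,
    Complex.conj_im, Complex.zero_re] at hd1
  have hoff : ‖M i 0 1‖ ≤ 1 := by
    rw [← sq_le_sq₀ (norm_nonneg _) zero_le_one, Complex.sq_norm, Complex.normSq_apply]
    nlinarith [hre 0, hre 1, mul_le_one₀ (hre 0).2 (hre 1).1 (hre 1).2]
  have hdiag : ∀ j, ‖M i j j‖ ≤ 1 := fun j => by
    have : M i j j = ((M i j j).re : ℂ) := Complex.ext rfl (him j)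
    rw [this, Complex.norm_real, Real.norm_eq_abs, abs_le]
    constructor <;> linarith [(hre j).1, (hre j).2]
  fin_cases j <;> fin_cases k
  · exact hdiag 0
  · exact hoff
  · simpa [hh 0 1] using hoff
  · exact hdiag 1

lemma isClosed_posSemidef : IsClosed {M : QubitOp | M.PosSemidef} := by
  simp only [posSemidef_iff_dotProduct_mulVec, Set.ofPred_and, Set.ofPred_forall]
  refine IsClosed.inter ?_ (isClosed_iInter fun x => ?_)
  · exact isClosed_eq (by fun_prop) continuous_id
  · exact isClosed_le continuous_const (by fun_prop)

lemma isCompact_isPOVM : IsCompact {M : Fin 3 → QubitOp | IsPOVM M} := by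
  have hK : IsCompact (Set.pi Set.univ fun _ : Fin 3 => Set.pi Set.univ fun _ : Fin 2 =>
      Set.pi Set.univ fun _ : Fin 2 => Metric.closedBall (0 : ℂ) 1) :=
    isCompact_univ_pi fun _ => isCompact_univ_pi fun _ => isCompact_univ_pi fun _ =>
      isCompact_closedBall 0 1
  refine IsCompact.of_isClosed_subset hK ?_ fun M hM => ?_
  · simp only [IsPOVM, Set.ofPred_and, Set.ofPred_forall]
    refine IsClosed.inter (isClosed_iInter fun i => ?_) ?_
    · exact IsClosed.preimage (f := fun M : Fin 3 → QubitOp => M i) (by fun_prop)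
        isClosed_posSemidef
    · exact isClosed_eq (by fun_prop) continuous_const
  · exact fun i _ j _ k _ => mem_closedBall_zero_iff.mpr (isPOVM_entry_norm_le hM i j k)

lemma isPOVM_trivial : IsPOVM ![1, 0, 0] := by
  refine ⟨fun i => ?_, by simp [Fin.sum_univ_three]⟩
  fin_cases i
  · exact PosSemidef.one
  · exact PosSemidef.zero
  · exact PosSemidef.zero

lemma exists_isPOVM_max (A : Fin 3 → QubitOp) :
    ∃ M, IsPOVM M ∧ ∀ N, IsPOVM N → povmValue A N ≤ povmValue A M := by
  obtain ⟨M, hM, hmax⟩ := isCompact_isPOVM.exists_isMaxOn ⟨_, isPOVM_trivial⟩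
    (f := povmValue A) (by unfold povmValue; fun_prop)
  exact ⟨M, hM, fun N hN => hmax hN⟩

/-- First-order necessary condition at the endpoint of an interval: dividing by `ε` and letting `ε`
tend to `0` leaves `t ≤ 0`. -/
lemma nonpos_of_forall_quadratic {t c δ : ℝ} (hδ : 0 < δ)
    (h : ∀ ε, 0 < ε → ε ≤ δ → ε * t + ε ^ 2 * c ≤ 0) : t ≤ 0 := by
  by_contra! ht
  set ε := min δ (t / (2 * (|c| + 1))) with hε
  have hc : 0 < 2 * (|c| + 1) := by positivity
  have hpos : 0 < ε := lt_min hδ (div_pos ht hc)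
  have h1 := h ε hpos (min_le_left _ _)
  have h2 : ε * (2 * (|c| + 1)) ≤ t := (le_div_iff₀ hc).mp (min_le_right _ _)
  have h3 : t + ε * c ≤ 0 := by
    by_contra! h4
    nlinarith [mul_pos hpos h4]
  nlinarith [neg_abs_le c, mul_le_mul_of_nonneg_left (neg_abs_le c) hpos.le]

/-- Optimality conditions for state discrimination: an optimal measurement has a Lagrange
operator. -/
lemma exists_lagrange_of_max {A M : Fin 3 → QubitOp} (hA : ∀ i, (A i).IsHermitian)
    (hM : IsPOVM M) (hmax : ∀ N, IsPOVM N → povmValue A N ≤ povmValue A M) :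
    ∃ L : QubitOp, (∀ i, (L - A i).PosSemidef) ∧ ∀ i, (L - A i) * M i = 0 := by
  set K : QubitOp := ∑ i, A i * M i with hK
  have hKH : Kᴴ = ∑ i, M i * A i := by
    simp only [hK, conjTranspose_sum, conjTranspose_mul, (hA _).eq, (hM.1 _).isHermitian.eq]
  -- `K` is not yet known to be Hermitian, so its Hermitian part is used; complementarity comes out
  -- at the end.
  set L : QubitOp := (1 / 2 : ℂ) • (K + Kᴴ) with hL
  have hLH : L.IsHermitian := by
    simp only [Matrix.IsHermitian, hL, conjTranspose_smul, conjTranspose_add,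
      conjTranspose_conjTranspose]
    rw [add_comm]; simp
  have hpsd : ∀ k, (L - A k).PosSemidef := fun k => by
    refine PosSemidef.of_dotProduct_mulVec_nonneg (hLH.sub (hA k)) fun x => ?_
    set P : QubitOp := vecMulVec x (star x) with hP
    have hPP : P.PosSemidef := posSemidef_vecMulVec_self_star x
    have htr : ∀ B : QubitOp, star x ⬝ᵥ (B *ᵥ x) = (B * P).trace := fun B => by
      rw [hP, mul_vecMulVec, trace_vecMulVec, dotProduct_comm]
    have hLkH : (star x ⬝ᵥ ((L - A k) *ᵥ x)).im = 0 :=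
      (hLH.sub (hA k)).im_star_dotProduct_mulVec_self x
    refine Complex.le_def.mpr ⟨?_, hLkH.symm⟩
    rw [htr, Complex.zero_re]
    set s : ℝ := (star x ⬝ᵥ x).re with hs
    have hs0 : 0 ≤ star x ⬝ᵥ x := dotProduct_star_self_nonneg x
    have hsx : star x ⬝ᵥ x = (s : ℂ) := Complex.ext rfl (Complex.le_def.mp hs0).2.symm
    have hs' : 0 ≤ s := (Complex.le_def.mp hs0).1
    have hPsq : P * P = (s : ℂ) • P := by
      rw [hP, vecMulVec_mul_vecMulVec, hsx, vecMulVec_smul]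
    have hKP : (K * P).trace + (Kᴴ * P).trace = 2 * (L * P).trace := by
      rw [hL, smul_mul_assoc, trace_smul, add_mul, trace_add, smul_eq_mul]; ring
    have key := nonpos_of_forall_quadratic (t := -2 * (((L - A k) * P).trace).re)
      (c := (∑ i, A i * P * M i * P).trace.re - s * ((A k * P).trace).re)
      (δ := 1 / (s + 1)) (by positivity) fun ε hε hεs => by
        have hε1 : ε * s ≤ 1 := by
          have := (le_div_iff₀ (by positivity : 0 < s + 1)).mp hεs
          nlinarith
        set Q : QubitOp := 1 - (ε : ℂ) • P with hQ
        have hQH : Qᴴ = Q := by simp [hQ, hPP.isHermitian.eq]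
        -- Competing POVM: compress every outcome by `Q = 1 - εP` and give the missing part `1 - Q²
        -- = (2ε - ε²s)P` to outcome `k`. The bound `ε ≤ 1/(s+1)` keeps this part nonnegative. The
        -- first-order change of the value is `-2 tr[(L - Aₖ)P]`.
        let N : Fin 3 → QubitOp := fun i =>
          Q * M i * Q + if i = k then ((2 * ε - ε ^ 2 * s : ℝ) : ℂ) • P else 0
        have hN : IsPOVM N := by
          refine ⟨fun i => ?_, ?_⟩
          · refine PosSemidef.add ?_ ?_
            · have := (hM.1 i).conjTranspose_mul_mul_same Q
              rwa [hQH] at this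
            · split_ifs
              · refine hPP.smul (Complex.zero_le_real.mpr ?_)
                nlinarith
              · exact PosSemidef.zero
          · simp only [N, Finset.sum_add_distrib, Finset.sum_ite_eq', Finset.mem_univ, if_true]
            rw [← Finset.sum_mul, ← Finset.mul_sum, hM.2, mul_one, hQ]
            simp only [sub_mul, mul_sub, one_mul, mul_one, smul_mul_assoc, mul_smul_comm, hPsq]
            push_cast
            module
        have hval : povmValue A N = povmValue A M - ε * (2 * (L * P).trace).re
            + ε ^ 2 * (∑ i, A i * P * M i * P).trace.re
            + (2 * ε - ε ^ 2 * s) * ((A k * P).trace).re := by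
          have h1 : ∑ i, A i * N i = K - (ε : ℂ) • (∑ i, A i * P * M i + K * P)
              + ((ε : ℂ) ^ 2) • ∑ i, A i * P * M i * P
              + ((2 * ε - ε ^ 2 * s : ℝ) : ℂ) • (A k * P) := by
            simp only [N, mul_add, Finset.sum_add_distrib, mul_ite, mul_zero, Finset.sum_ite_eq',
              Finset.mem_univ, if_true, mul_smul_comm]
            congr 1
            rw [hK, Finset.sum_mul, ← Finset.sum_add_distrib, Finset.smul_sum, Finset.smul_sum,
              ← Finset.sum_sub_distrib, ← Finset.sum_add_distrib]
            refine Finset.sum_congr rfl fun i _ => ?_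
            simp only [hQ, sub_mul, mul_sub, one_mul, mul_one, smul_mul_assoc, mul_smul_comm,
              ← Matrix.mul_assoc]
            module
          have h2 : (∑ i, A i * P * M i).trace = (Kᴴ * P).trace := by
            rw [hKH, Finset.sum_mul, trace_sum, trace_sum]
            refine Finset.sum_congr rfl fun i _ => ?_
            rw [Matrix.trace_mul_comm, Matrix.mul_assoc]
          rw [povmValue, ← Complex.re_sum, ← trace_sum, h1]
          rw [← hKP, ← h2, povmValue, ← Complex.re_sum, ← trace_sum, ← hK]
          simp only [trace_add, trace_sub, trace_smul, smul_eq_mul, Complex.add_re, Complex.sub_re,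
            Complex.re_ofReal_mul, ← Complex.ofReal_pow]
          ring
        have h3 := hmax N hN
        rw [hval] at h3
        simp only [sub_mul, trace_sub, Complex.sub_re, Complex.mul_re, Complex.re_ofNat,
          Complex.im_ofNat, zero_mul, sub_zero] at h3 ⊢
        nlinarith
    linarith
  refine ⟨L, hpsd, ?_⟩
  -- `L` and `K` have traces with the same real part; nonnegative terms summing to zero all vanish.
  have hsum : ∑ i, (((L - A i) * M i).trace).re = 0 := by
    have h1 : ∑ i, (L - A i) * M i = L - K := by
      simp only [sub_mul, Finset.sum_sub_distrib, ← Finset.mul_sum, hM.2, mul_one, hK]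
    rw [← Complex.re_sum, ← trace_sum, h1, hL]
    simp [trace_conjTranspose]
    ring
  have hz := (Finset.sum_eq_zero_iff_of_nonneg
    (fun i _ => trace_mul_re_nonneg (hpsd i) (hM.1 i))).mp hsum
  exact fun i => mul_eq_zero_of_trace_re_eq_zero (hpsd i) (hM.1 i) (hz i (Finset.mem_univ i))

lemma povmValue_eq_of_lagrange {A M : Fin 3 → QubitOp} {L : QubitOp} (hM : IsPOVM M)
    (hz : ∀ i, (L - A i) * M i = 0) : povmValue A M = (L.trace).re := by
  have h : ∀ i, A i * M i = L * M i := fun i => by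
    have := hz i; rw [sub_mul, sub_eq_zero] at this; exact this.symm
  simp only [povmValue, h]
  rw [← Complex.re_sum, ← trace_sum, ← Finset.mul_sum, hM.2, mul_one]

lemma povmValue_sub_trace {A M : Fin 3 → QubitOp} (L : QubitOp) (hM : IsPOVM M) :
    (L.trace).re - povmValue A M = ∑ i, (((L - A i) * M i).trace).re := by
  have h1 : ∑ i, (L - A i) * M i = L - ∑ i, A i * M i := by
    simp only [sub_mul, Finset.sum_sub_distrib, ← Finset.mul_sum, hM.2, mul_one]
  rw [← Complex.re_sum, ← trace_sum, h1, povmValue, ← Complex.re_sum, ← trace_sum]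
  simp

lemma povmValue_le_of_lagrange {A M : Fin 3 → QubitOp} {L : QubitOp} (hM : IsPOVM M)
    (hp : ∀ i, (L - A i).PosSemidef) : povmValue A M ≤ (L.trace).re := by
  have := povmValue_sub_trace (A := A) L hM
  have h2 : 0 ≤ ∑ i, (((L - A i) * M i).trace).re :=
    Finset.sum_nonneg fun i _ => trace_mul_re_nonneg (hp i) (hM.1 i)
  linarith

lemma mul_eq_zero_of_value_eq {A M : Fin 3 → QubitOp} {L : QubitOp} (hM : IsPOVM M)
    (hp : ∀ i, (L - A i).PosSemidef) (h : povmValue A M = (L.trace).re) (i : Fin 3) :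
    (L - A i) * M i = 0 := by
  have h1 := povmValue_sub_trace (A := A) L hM
  rw [h, sub_self] at h1
  have hz := (Finset.sum_eq_zero_iff_of_nonneg
    (fun i _ => trace_mul_re_nonneg (hp i) (hM.1 i))).mp h1.symm
  exact mul_eq_zero_of_trace_re_eq_zero (hp i) (hM.1 i) (hz i (Finset.mem_univ i))

/-! ### The modified problem, its Lagrange operators and the special inconclusive degrees. -/

namespace QubitEnsemble

variable (E : QubitEnsemble)

/-- The weighted states `qρ₀, q₁ρ₁, q₂ρ₂`. -/
noncomputable def wstate (q : ℝ) (i : Fin 3) : QubitOp := (E.weight q i : ℂ) • E.state i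

lemma pbarCor_eq (q : ℝ) (M : Fin 3 → QubitOp) : E.pbarCor q M = povmValue (E.wstate q) M := by
  simp only [pbarCor, povmValue, wstate, smul_mul_assoc, trace_smul, smul_eq_mul,
    Complex.re_ofReal_mul]

lemma ρ₀_posDef : E.ρ₀.PosDef := E.avg_full

lemma state_posSemidef (i : Fin 3) : (E.state i).PosSemidef := by
  fin_cases i
  · exact E.ρ₀_posDef.posSemidef
  · exact E.ρ₁_psd
  · exact E.ρ₂_psd

lemma ρ₀_trace : E.ρ₀.trace = 1 := by
  simp only [ρ₀, trace_add, trace_smul, E.ρ₁_trace, E.ρ₂_trace, smul_eq_mul, mul_one]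
  exact_mod_cast E.q_sum

lemma state_trace (i : Fin 3) : (E.state i).trace = 1 := by
  fin_cases i
  · exact E.ρ₀_trace
  · exact E.ρ₁_trace
  · exact E.ρ₂_trace

lemma wstate_isHermitian (q : ℝ) (i : Fin 3) : (E.wstate q i).IsHermitian := by
  simp [Matrix.IsHermitian, wstate, (E.state_posSemidef i).isHermitian.eq]

lemma wstate_zero (q : ℝ) : E.wstate q 0 = (q : ℂ) • E.ρ₀ := rfl
lemma wstate_one (q : ℝ) : E.wstate q 1 = (E.q₁ : ℂ) • E.ρ₁ := rfl
lemma wstate_two (q : ℝ) : E.wstate q 2 = (E.q₂ : ℂ) • E.ρ₂ := rfl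

lemma wstate_trace (q : ℝ) (i : Fin 3) : ((E.wstate q i).trace).re = E.weight q i := by
  simp [wstate, E.state_trace]

lemma exists_isOptimal_aux (q : ℝ) :
    ∃ M, IsPOVM M ∧ E.pbarOpt q = E.pbarCor q M ∧ ∀ N, IsPOVM N → E.pbarCor q N ≤ E.pbarOpt q := by
  obtain ⟨M, hM, hmax⟩ := exists_isPOVM_max (E.wstate q)
  have h : IsGreatest (E.pbarCor q '' {M | IsPOVM M}) (E.pbarCor q M) := by
    refine ⟨⟨M, hM, rfl⟩, ?_⟩
    rintro _ ⟨N, hN, rfl⟩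
    simpa only [pbarCor_eq] using hmax N hN
  have h2 : E.pbarOpt q = E.pbarCor q M := h.csSup_eq
  exact ⟨M, hM, h2, fun N hN => h2 ▸ h.2 ⟨N, hN, rfl⟩⟩

variable {E} {q : ℝ}

lemma exists_isOptimal (E : QubitEnsemble) (q : ℝ) : ∃ M, E.IsOptimal q M := by
  obtain ⟨M, hM, h, -⟩ := E.exists_isOptimal_aux q
  exact ⟨M, hM, h.symm⟩

lemma pbarCor_le {N : Fin 3 → QubitOp} (hN : IsPOVM N) : E.pbarCor q N ≤ E.pbarOpt q := by
  obtain ⟨-, -, -, h⟩ := E.exists_isOptimal_aux q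
  exact h N hN

lemma isOptimal_of_le {M : Fin 3 → QubitOp} (hM : IsPOVM M) (h : E.pbarOpt q ≤ E.pbarCor q M) :
    E.IsOptimal q M := ⟨hM, le_antisymm (pbarCor_le hM) h⟩

/-- A Lagrange operator of the modified problem: a feasible point of the dual problem which is
complementary to the optimal POVMs. -/
def IsLagrange (E : QubitEnsemble) (q : ℝ) (L : QubitOp) : Prop :=
  (∀ i, (L - E.wstate q i).PosSemidef) ∧ E.pbarOpt q = (L.trace).re

lemma IsLagrange.mul_eq_zero {L : QubitOp} (hL : E.IsLagrange q L) {M : Fin 3 → QubitOp}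
    (hM : E.IsOptimal q M) (i : Fin 3) : (L - E.wstate q i) * M i = 0 :=
  mul_eq_zero_of_value_eq hM.1 hL.1 (by rw [← pbarCor_eq, hM.2, hL.2]) i

lemma exists_isLagrange (E : QubitEnsemble) (q : ℝ) : ∃ L, E.IsLagrange q L := by
  obtain ⟨M, hM⟩ := E.exists_isOptimal q
  obtain ⟨L, hL, hz⟩ := exists_lagrange_of_max (E.wstate_isHermitian q) hM.1 fun N hN => by
    rw [← pbarCor_eq, ← pbarCor_eq, hM.2]; exact pbarCor_le hN
  exact ⟨L, hL, by rw [← hM.2, pbarCor_eq, povmValue_eq_of_lagrange hM.1 hz]⟩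

lemma IsLagrange.isOptimal {L : QubitOp} (hL : E.IsLagrange q L) {M : Fin 3 → QubitOp}
    (hM : IsPOVM M) (hz : ∀ i, (L - E.wstate q i) * M i = 0) : E.IsOptimal q M :=
  ⟨hM, by rw [hL.2, pbarCor_eq, povmValue_eq_of_lagrange hM hz]⟩

lemma isLagrange_of_psd {L : QubitOp} (hL : ∀ i, (L - E.wstate q i).PosSemidef)
    {M : Fin 3 → QubitOp} (hM : IsPOVM M) (hz : ∀ i, (L - E.wstate q i) * M i = 0) :
    E.IsLagrange q L := by
  refine ⟨hL, le_antisymm ?_ ?_⟩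
  · obtain ⟨N, hN⟩ := E.exists_isOptimal q
    rw [← hN.2, pbarCor_eq]
    exact povmValue_le_of_lagrange hN.1 hL
  · rw [← povmValue_eq_of_lagrange hM hz, ← pbarCor_eq]
    exact pbarCor_le hM

lemma isPOVM_vec {A B C : QubitOp} (hA : A.PosSemidef) (hB : B.PosSemidef) (hC : C.PosSemidef)
    (h : A + B + C = 1) : IsPOVM ![A, B, C] := by
  refine ⟨fun i => ?_, by simpa [Fin.sum_univ_three] using h⟩
  fin_cases i
  · exact hA
  · exact hB
  · exact hC

lemma pbarCor_expand (M : Fin 3 → QubitOp) :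
    E.pbarCor q M = q * ((E.ρ₀ * M 0).trace).re + ((E.wstate q 1 * M 1).trace).re
      + ((E.wstate q 2 * M 2).trace).re := by
  rw [pbarCor_eq, povmValue, Fin.sum_univ_three, wstate_zero, smul_mul_assoc, trace_smul,
    smul_eq_mul, Complex.re_ofReal_mul]

lemma IsPOVM.one_sub_posSemidef {M : Fin 3 → QubitOp} (hM : IsPOVM M) (i : Fin 3) :
    (1 - M i).PosSemidef := by
  rw [← hM.2, ← Finset.sum_erase_eq_sub (Finset.mem_univ i)]
  exact posSemidef_sum _ fun j _ => hM.1 j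

lemma trace_state_mul_le_one {M : Fin 3 → QubitOp} (hM : IsPOVM M) (i j : Fin 3) :
    ((E.state i * M j).trace).re ≤ 1 := by
  have := trace_mul_re_nonneg (E.state_posSemidef i) (IsPOVM.one_sub_posSemidef hM j)
  rw [mul_sub, mul_one, trace_sub, E.state_trace] at this
  simpa using this

/-- Always answering "inconclusive" has value `q`, whereas an optimal POVM with `tr[ρ₀M₀] = 0` has
value at most `q₁ + q₂ = 1`. -/
lemma le_one_of_zero_mem_PI (h : (0 : ℝ) ∈ E.PI q) : q ≤ 1 := by
  obtain ⟨M, hM, h0⟩ := h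
  have h1 := pbarCor_le (E := E) (q := q) isPOVM_trivial
  rw [← hM.2, pbarCor_expand, pbarCor_expand, h0] at h1
  simp only [cons_val_zero, cons_val_one, cons_val, mul_zero, mul_one, trace_zero,
    E.ρ₀_trace, Complex.one_re, Complex.zero_re, wstate_one, wstate_two, smul_mul_assoc,
    trace_smul, smul_eq_mul, Complex.re_ofReal_mul, zero_add, add_zero] at h1
  have h2 := trace_state_mul_le_one (E := E) hM.1 1 1
  have h3 := trace_state_mul_le_one (E := E) hM.1 2 2
  have h4 : ((E.ρ₁ * M 1).trace).re ≤ 1 := h2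
  have h5 : ((E.ρ₂ * M 2).trace).re ≤ 1 := h3
  nlinarith [E.q₁_nonneg, E.q₂_nonneg, E.q_sum]

lemma bddAbove_low (E : QubitEnsemble) : BddAbove {q | 0 < q ∧ (0 : ℝ) ∈ E.PI q} :=
  ⟨1, fun _ h => le_one_of_zero_mem_PI h.2⟩

lemma half_le_qLow (E : QubitEnsemble) : 1 / 2 ≤ E.qLow := by
  refine le_csSup E.bddAbove_low ⟨by norm_num, ?_⟩
  obtain ⟨M, hM⟩ := E.exists_isOptimal (1 / 2)
  have hh : ((1 / 2 : ℂ) • M 0).PosSemidef :=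
    (hM.1.1 0).smul (by rw [Complex.le_def]; norm_num)
  -- At `q = 1/2` the inconclusive outcome is worth exactly a fair coin toss between the two
  -- guesses, so it can be shared out at no cost.
  have hN : IsPOVM ![0, M 1 + (1 / 2 : ℂ) • M 0, M 2 + (1 / 2 : ℂ) • M 0] := by
    refine isPOVM_vec PosSemidef.zero ((hM.1.1 1).add hh) ((hM.1.1 2).add hh) ?_
    rw [← hM.1.2, Fin.sum_univ_three]
    module
  refine ⟨_, isOptimal_of_le hN ?_, by simp⟩
  rw [← hM.2, pbarCor_expand, pbarCor_expand]
  simp only [cons_val_zero, cons_val_one, cons_val, mul_zero, trace_zero, mul_add, mul_smul_comm,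
    trace_add, trace_smul, smul_eq_mul, Complex.add_re, Complex.zero_re, wstate_one, wstate_two,
    smul_mul_assoc, ρ₀, add_mul, Complex.re_ofReal_mul]
  have h2 : (1 / 2 : ℂ) = ((1 / 2 : ℝ) : ℂ) := by push_cast; rfl
  rw [h2]
  simp only [Complex.re_ofReal_mul]
  linarith

lemma zero_notMem_PI (hq : E.qLow < q) : (0 : ℝ) ∉ E.PI q := fun h =>
  not_le.mpr hq (le_csSup E.bddAbove_low
    ⟨by linarith [E.half_le_qLow], h⟩)

lemma le_of_one_mem_PI {p : ℝ} (hp : 0 < p) (h : (1 : ℝ) ∈ E.PI p) : E.qHigh ≤ p :=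
  csInf_le ⟨0, fun _ h => h.1.le⟩ ⟨hp, h⟩

/-! Square root of the average state -/

lemma rootAvg_sq (E : QubitEnsemble) : E.rootAvg * E.rootAvg = E.ρ₀ :=
  CFC.sqrt_mul_sqrt_self _ E.ρ₀_posDef.posSemidef.nonneg

lemma rootAvg_isHermitian (E : QubitEnsemble) : E.rootAvgᴴ = E.rootAvg :=
  (nonneg_iff_posSemidef.mp (CFC.sqrt_nonneg E.ρ₀)).isHermitian

lemma rootAvg_isUnit_det (E : QubitEnsemble) : IsUnit E.rootAvg.det := by
  have h : IsUnit E.ρ₀.det := (isUnit_iff_isUnit_det _).mp E.ρ₀_posDef.isUnit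
  rw [← rootAvg_sq, det_mul] at h
  exact isUnit_of_mul_isUnit_left h

lemma rootAvg_inv_isHermitian (E : QubitEnsemble) : E.rootAvg⁻¹ᴴ = E.rootAvg⁻¹ := by
  rw [conjTranspose_nonsing_inv, rootAvg_isHermitian]

lemma inv_mul_ρ₀_mul_inv (E : QubitEnsemble) : E.rootAvg⁻¹ * E.ρ₀ * E.rootAvg⁻¹ = 1 := by
  rw [← rootAvg_sq, ← Matrix.mul_assoc, nonsing_inv_mul _ E.rootAvg_isUnit_det, Matrix.one_mul,
    mul_nonsing_inv _ E.rootAvg_isUnit_det]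

lemma barState_add (E : QubitEnsemble) : E.barState₁ + E.barState₂ = 1 := by
  rw [barState₁, barState₂, ← Matrix.add_mul, ← Matrix.mul_add]
  exact E.inv_mul_ρ₀_mul_inv

lemma inv_conj_posSemidef (E : QubitEnsemble) {A : QubitOp} (hA : A.PosSemidef) :
    (E.rootAvg⁻¹ * A * E.rootAvg⁻¹).PosSemidef := by
  have := hA.conjTranspose_mul_mul_same E.rootAvg⁻¹
  rwa [rootAvg_inv_isHermitian] at this

lemma conj_posSemidef (E : QubitEnsemble) {A : QubitOp} (hA : A.PosSemidef) :
    (E.rootAvg * A * E.rootAvg).PosSemidef := by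
  have := hA.conjTranspose_mul_mul_same E.rootAvg
  rwa [rootAvg_isHermitian] at this

lemma conj_inv_conj (E : QubitEnsemble) (A : QubitOp) :
    E.rootAvg * (E.rootAvg⁻¹ * A * E.rootAvg⁻¹) * E.rootAvg = A := by
  have h := E.rootAvg_isUnit_det
  simp only [← Matrix.mul_assoc, mul_nonsing_inv _ h, Matrix.one_mul]
  rw [Matrix.mul_assoc, nonsing_inv_mul _ h, Matrix.mul_one]

lemma barState₁_posSemidef (E : QubitEnsemble) : E.barState₁.PosSemidef :=
  E.inv_conj_posSemidef (E.ρ₁_psd.smul (Complex.zero_le_real.mpr E.q₁_nonneg))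

lemma barState₂_posSemidef (E : QubitEnsemble) : E.barState₂.PosSemidef :=
  E.inv_conj_posSemidef (E.ρ₂_psd.smul (Complex.zero_le_real.mpr E.q₂_nonneg))

lemma sSup_spectrum_sub_posSemidef {A : QubitOp} (hA : A.IsHermitian) :
    (((sSup (spectrum ℝ A) : ℝ) : ℂ) • (1 : QubitOp) - A).PosSemidef := by
  have h : A ≤ algebraMap ℝ QubitOp (sSup (spectrum ℝ A)) := by
    rw [le_algebraMap_iff_spectrum_le hA]
    exact fun x hx => le_csSup (Matrix.finite_real_spectrum).bddAbove hx
  have h2 := Matrix.le_iff.mp h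
  rwa [Algebra.algebraMap_eq_smul_one, ← Complex.coe_smul] at h2

/-- Conjugation of `C₁ I - ρ̄₁ ≥ 0` by `ρ₀^{1/2}`. -/
lemma C₁_smul_ρ₀_sub (E : QubitEnsemble) :
    ((E.C₁ : ℂ) • E.ρ₀ - (E.q₁ : ℂ) • E.ρ₁).PosSemidef := by
  have h := E.conj_posSemidef (sSup_spectrum_sub_posSemidef E.barState₁_posSemidef.isHermitian)
  rw [mul_sub, sub_mul, barState₁, conj_inv_conj] at h
  rwa [mul_smul_comm, Matrix.mul_one, smul_mul_assoc, rootAvg_sq] at h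

lemma C₂_smul_ρ₀_sub (E : QubitEnsemble) :
    ((E.C₂ : ℂ) • E.ρ₀ - (E.q₂ : ℂ) • E.ρ₂).PosSemidef := by
  have h := E.conj_posSemidef (sSup_spectrum_sub_posSemidef E.barState₂_posSemidef.isHermitian)
  rw [mul_sub, sub_mul, barState₂, conj_inv_conj] at h
  rwa [mul_smul_comm, Matrix.mul_one, smul_mul_assoc, rootAvg_sq] at h

lemma posSemidef_smul_mono {A B : QubitOp} {c d : ℝ} (hcd : c ≤ d) (hB : B.PosSemidef)
    (h : ((c : ℂ) • B - A).PosSemidef) : ((d : ℂ) • B - A).PosSemidef := by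
  have h2 := h.add (hB.smul (Complex.zero_le_real.mpr (sub_nonneg.mpr hcd)))
  convert h2 using 1
  push_cast
  module

lemma one_le_C₁_add_C₂ (E : QubitEnsemble) : 1 ≤ E.C₁ + E.C₂ := by
  have h := (E.C₁_smul_ρ₀_sub.add E.C₂_smul_ρ₀_sub).trace_nonneg
  have h2 := (Complex.le_def.mp h).1
  simp only [trace_add, trace_sub, trace_smul, E.ρ₀_trace, E.ρ₁_trace, E.ρ₂_trace, smul_eq_mul,
    mul_one, Complex.add_re, Complex.sub_re, Complex.ofReal_re, Complex.zero_re] at h2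
  linarith [E.q_sum]

/-- If `c ≥ C₁, C₂` then the trivial measurement is optimal at `q = c`. -/
lemma isLagrange_smul_ρ₀ {c : ℝ} (h₁ : E.C₁ ≤ c) (h₂ : E.C₂ ≤ c) :
    E.IsLagrange c ((c : ℂ) • E.ρ₀) := by
  refine isLagrange_of_psd (M := ![1, 0, 0]) (fun i => ?_) isPOVM_trivial fun i => ?_
  · fin_cases i
    · simpa [wstate_zero] using PosSemidef.zero
    · exact posSemidef_smul_mono h₁ E.ρ₀_posDef.posSemidef E.C₁_smul_ρ₀_sub
    · exact posSemidef_smul_mono h₂ E.ρ₀_posDef.posSemidef E.C₂_smul_ρ₀_sub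
  · fin_cases i <;> simp [wstate_zero]

lemma qHigh_le_C₂ (hC : E.C₁ ≤ E.C₂) : E.qHigh ≤ E.C₂ := by
  have h := E.one_le_C₁_add_C₂
  refine le_of_one_mem_PI (by linarith) ⟨![1, 0, 0], ?_, by simp [E.ρ₀_trace]⟩
  refine (isLagrange_smul_ρ₀ hC le_rfl).isOptimal isPOVM_trivial fun i => ?_
  fin_cases i <;> simp [wstate_zero]

/-- If `C₁ + C₂ = 1`, always guessing state 2 has value `q₂ = 1 - q₁ ≥ 1 - C₁ = C₂`, which is the
optimum at `q = C₂`. Then `C₂ ≤ q₀⁽⁰⁾`, against `q₀⁽⁰⁾ < q₀⁽¹⁾ ≤ C₂`. -/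
lemma one_lt_C₁_add_C₂ (hC : E.C₁ ≤ E.C₂) (h : E.qLow < E.qHigh) : 1 < E.C₁ + E.C₂ := by
  refine lt_of_le_of_ne E.one_le_C₁_add_C₂ fun heq => ?_
  refine not_le.mpr (h.trans_le (qHigh_le_C₂ hC)) (le_csSup E.bddAbove_low ⟨by linarith, ?_⟩)
  have hN : IsPOVM ![(0 : QubitOp), 0, 1] :=
    isPOVM_vec PosSemidef.zero PosSemidef.zero PosSemidef.one (by simp)
  refine ⟨_, isOptimal_of_le hN ?_, by simp⟩
  rw [(isLagrange_smul_ρ₀ hC le_rfl).2, pbarCor_expand]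
  have h2 := (Complex.le_def.mp E.C₁_smul_ρ₀_sub.trace_nonneg).1
  simp only [trace_sub, trace_smul, E.ρ₀_trace, E.ρ₁_trace, E.ρ₂_trace, smul_eq_mul,
    mul_one, Complex.sub_re, Complex.ofReal_re, Complex.zero_re, cons_val_zero, cons_val_one,
    cons_val, mul_zero, trace_zero, wstate_two] at h2 ⊢
  linarith [E.q_sum]

end QubitEnsemble

/-! ### Bloch representation of qubit operators. -/

lemma dotPauli_eq (n : EuclideanSpace ℝ (Fin 3)) :
    dotPauli n = !![(n 2 : ℂ), n 0 - Complex.I * n 1; n 0 + Complex.I * n 1, -(n 2 : ℂ)] := by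
  ext i j
  fin_cases i <;> fin_cases j <;> simp [dotPauli, pauli, Fin.sum_univ_three] <;> ring

lemma dotPauli_neg (n : EuclideanSpace ℝ (Fin 3)) : dotPauli (-n) = -dotPauli n := by
  simp [dotPauli]

lemma dotPauli_isHermitian (n : EuclideanSpace ℝ (Fin 3)) : (dotPauli n)ᴴ = dotPauli n := by
  rw [dotPauli_eq]
  ext i j
  fin_cases i <;> fin_cases j <;> simp <;> ring

lemma trace_dotPauli (n : EuclideanSpace ℝ (Fin 3)) : (dotPauli n).trace = 0 := by
  simp [dotPauli_eq, trace_fin_two]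

lemma dotPauli_mul_self (n : EuclideanSpace ℝ (Fin 3)) :
    dotPauli n * dotPauli n = ((‖n‖ ^ 2 : ℝ) : ℂ) • 1 := by
  have hI : Complex.I * Complex.I = -1 := Complex.I_mul_I
  rw [EuclideanSpace.norm_sq_eq, Fin.sum_univ_three, dotPauli_eq]
  ext i j
  fin_cases i <;> fin_cases j <;>
    simp [mul_apply, Fin.sum_univ_two] <;> ring_nf <;> simp [Complex.I_sq]

lemma trace_mul_dotPauli_re (A : QubitOp) (n : EuclideanSpace ℝ (Fin 3)) :
    ((A * dotPauli n).trace).re = inner ℝ n (bloch A) := by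
  simp only [dotPauli, Finset.mul_sum, mul_smul_comm, trace_sum, trace_smul, Complex.re_sum,
    smul_eq_mul, Complex.re_ofReal_mul, PiLp.inner_apply, bloch]
  refine Finset.sum_congr rfl fun i _ => ?_
  simp [mul_comm]

lemma bloch_apply (A : QubitOp) : bloch A 0 = (A 0 1 + A 1 0).re ∧
    bloch A 1 = (Complex.I * (A 0 1 - A 1 0)).re ∧ bloch A 2 = (A 0 0 - A 1 1).re := by
  refine ⟨?_, ?_, ?_⟩ <;> simp [bloch, pauli, trace_fin_two, mul_apply, Fin.sum_univ_two] <;> ring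

lemma eq_bloch_of_isHermitian {A : QubitOp} (hA : A.IsHermitian) :
    A = (1 / 2 : ℂ) • (((A.trace).re : ℂ) • (1 : QubitOp) + dotPauli (bloch A)) := by
  have h10 : A 1 0 = star (A 0 1) := (hA.apply 1 0).symm
  have h00 : (A 0 0).im = 0 := Complex.conj_eq_iff_im.mp (hA.apply 0 0)
  have h11 : (A 1 1).im = 0 := Complex.conj_eq_iff_im.mp (hA.apply 1 1)
  obtain ⟨b0, b1, b2⟩ := bloch_apply A
  rw [dotPauli_eq, b0, b1, b2, trace_fin_two, h10]
  ext i j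
  fin_cases i <;> fin_cases j <;> apply Complex.ext <;> simp [h00, h11, h10] <;> ring

/-- Four times the determinant is the squared trace minus the squared norm of the Bloch vector. -/
lemma norm_bloch_le_trace {A : QubitOp} (hA : A.PosSemidef) : ‖bloch A‖ ≤ (A.trace).re := by
  have h10 : A 1 0 = star (A 0 1) := (hA.isHermitian.apply 1 0).symm
  have h00 : (A 0 0).im = 0 := Complex.conj_eq_iff_im.mp (hA.isHermitian.apply 0 0)
  have h11 : (A 1 1).im = 0 := Complex.conj_eq_iff_im.mp (hA.isHermitian.apply 1 1)
  have ht : 0 ≤ (A.trace).re := (Complex.le_def.mp hA.trace_nonneg).1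
  have hd := (Complex.le_def.mp hA.det_nonneg).1
  rw [← sq_le_sq₀ (norm_nonneg _) ht, EuclideanSpace.norm_sq_eq, Fin.sum_univ_three]
  obtain ⟨b0, b1, b2⟩ := bloch_apply A
  rw [b0, b1, b2]
  simp [det_fin_two, trace_fin_two, h10, h00, h11] at hd ⊢
  nlinarith

/-- The qubit effect `(I + d · σ / ‖d‖) / 2`. -/
noncomputable def blochProj (d : EuclideanSpace ℝ (Fin 3)) : QubitOp :=
  (1 / 2 : ℂ) • (1 + dotPauli (‖d‖⁻¹ • d))

lemma one_sub_blochProj (d : EuclideanSpace ℝ (Fin 3)) :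
    1 - blochProj d = (1 / 2 : ℂ) • (1 + dotPauli (‖d‖⁻¹ • -d)) := by
  rw [blochProj, smul_neg, dotPauli_neg]
  module

lemma one_sub_blochProj' (d : EuclideanSpace ℝ (Fin 3)) : 1 - blochProj d = blochProj (-d) := by
  rw [one_sub_blochProj, blochProj, norm_neg]

lemma blochProj_posSemidef (d : EuclideanSpace ℝ (Fin 3)) : (blochProj d).PosSemidef := by
  have hhalf : (0 : ℂ) ≤ 1 / 2 := by rw [Complex.le_def]; norm_num
  by_cases hd : d = 0
  -- Since `0⁻¹ = 0`, the operator for `d = 0` is `I/2`; otherwise it is a projection.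
  · have h0 : dotPauli (‖d‖⁻¹ • d) = 0 := by simp [hd, dotPauli]
    rw [blochProj, h0, add_zero]
    exact PosSemidef.one.smul hhalf
  · have hn : ‖‖d‖⁻¹ • d‖ = 1 := by
      rw [norm_smul, norm_inv, norm_norm, inv_mul_cancel₀ (norm_ne_zero_iff.mpr hd)]
    have hH : (blochProj d)ᴴ = blochProj d := by
      simp [blochProj, dotPauli_isHermitian]
    have hsq : blochProj d * blochProj d = blochProj d := by
      have := dotPauli_mul_self (‖d‖⁻¹ • d)
      rw [hn, one_pow, Complex.ofReal_one, one_smul] at this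
      rw [blochProj, smul_mul_smul_comm, mul_add, add_mul, add_mul, this]
      simp only [mul_one, one_mul]
      module
    have := posSemidef_conjTranspose_mul_self (blochProj d)
    rwa [hH, hsq] at this

lemma trace_blochProj (d : EuclideanSpace ℝ (Fin 3)) : ((blochProj d).trace).re = 1 := by
  simp [blochProj, trace_add, trace_dotPauli]

/-! ### Measurements with a vanishing conclusive outcome. -/

namespace QubitEnsemble

variable {E : QubitEnsemble} {q : ℝ}

/-- The measurement with outcomes `0` and `x` only and `M₀ = P`. -/
def twoOutcome (x : Fin 3) (P : QubitOp) : Fin 3 → QubitOp :=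
  fun i => if i = 0 then P else if i = x then 1 - P else 0

lemma twoOutcome_self {x : Fin 3} (hx : x ≠ 0) (P : QubitOp) : twoOutcome x P x = 1 - P := by
  simp [twoOutcome, hx]

lemma isPOVM_twoOutcome {x : Fin 3} (hx : x ≠ 0) {P : QubitOp} (hP : P.PosSemidef)
    (hP' : (1 - P).PosSemidef) : IsPOVM (twoOutcome x P) := by
  refine ⟨fun i => ?_, ?_⟩
  · unfold twoOutcome
    split_ifs
    exacts [hP, hP', PosSemidef.zero]
  · fin_cases x
    · exact absurd rfl hx
    · simp [twoOutcome, Fin.sum_univ_three]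
    · simp [twoOutcome, Fin.sum_univ_three]

lemma eq_twoOutcome {x y : Fin 3} (hxy : (x = 1 ∧ y = 2) ∨ (x = 2 ∧ y = 1))
    {M : Fin 3 → QubitOp} (hM : IsPOVM M) (hy : M y = 0) : M = twoOutcome x (M 0) := by
  have h := hM.2
  rw [Fin.sum_univ_three] at h
  funext i
  rcases hxy with ⟨rfl, rfl⟩ | ⟨rfl, rfl⟩ <;> fin_cases i <;> simp [twoOutcome, ← h, hy]

lemma blochDiff_eq_bloch (E : QubitEnsemble) (q : ℝ) (x : Fin 3) :
    E.blochDiff q x = bloch (E.wstate q 0 - E.wstate q x) := by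
  ext j
  change q * ((E.state 0 * pauli j).trace).re - _ = _
  simp only [bloch, wstate, sub_mul, trace_sub, smul_mul_assoc,
    trace_smul, smul_eq_mul, Complex.sub_re, Complex.re_ofReal_mul]
  rfl

lemma pbarCor_twoOutcome {x : Fin 3} (hx : x ≠ 0) (P : QubitOp) :
    E.pbarCor q (twoOutcome x P)
      = E.weight q x + (((E.wstate q 0 - E.wstate q x) * P).trace).re := by
  rw [pbarCor_eq, povmValue, ← E.wstate_trace q x]
  fin_cases x
  · exact absurd rfl hx
  · simp [twoOutcome, Fin.sum_univ_three, mul_sub, sub_mul]; ring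
  · simp [twoOutcome, Fin.sum_univ_three, mul_sub, sub_mul]; ring

lemma trace_wdiff_mul {x : Fin 3} {P : QubitOp} (hP : P.IsHermitian) :
    (((E.wstate q 0 - E.wstate q x) * P).trace).re
      = 1 / 2 * ((q - E.weight q x) * (P.trace).re + inner ℝ (bloch P) (E.blochDiff q x)) := by
  conv_lhs => rw [eq_bloch_of_isHermitian hP]
  have h2 : (1 / 2 : ℂ) = ((1 / 2 : ℝ) : ℂ) := by push_cast; rfl
  have h0 : E.weight q 0 = q := rfl
  rw [mul_smul_comm, trace_smul, mul_add, trace_add, mul_smul_comm, mul_one, trace_smul, h2,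
    smul_eq_mul, smul_eq_mul, Complex.re_ofReal_mul, Complex.add_re, Complex.re_ofReal_mul,
    trace_mul_dotPauli_re, blochDiff_eq_bloch, trace_sub, Complex.sub_re, wstate_trace, wstate_trace, h0]
  ring

lemma inner_normalize_self (d : EuclideanSpace ℝ (Fin 3)) : inner ℝ (‖d‖⁻¹ • d) d = ‖d‖ := by
  rw [real_inner_smul_left, real_inner_self_eq_norm_sq]
  by_cases h : ‖d‖ = 0
  · simp [h]
  · field_simp

lemma trace_mul_blochProj (A : QubitOp) (d : EuclideanSpace ℝ (Fin 3)) :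
    ((A * blochProj d).trace).re
      = 1 / 2 * ((A.trace).re + inner ℝ (‖d‖⁻¹ • d) (bloch A)) := by
  have h2 : (1 / 2 : ℂ) = ((1 / 2 : ℝ) : ℂ) := by push_cast; rfl
  rw [blochProj, mul_smul_comm, trace_smul, mul_add, mul_one, trace_add, h2, smul_eq_mul,
    Complex.re_ofReal_mul, Complex.add_re, trace_mul_dotPauli_re]

lemma pbarCor_blochProj {x : Fin 3} (hx : x ≠ 0) :
    E.pbarCor q (twoOutcome x (blochProj (E.blochDiff q x)))
      = 1 / 2 * (q + E.weight q x + ‖E.blochDiff q x‖) := by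
  have h0 : E.weight q 0 = q := rfl
  rw [pbarCor_twoOutcome hx, trace_mul_blochProj, ← blochDiff_eq_bloch, inner_normalize_self,
    trace_sub, Complex.sub_re, wstate_trace, wstate_trace, h0]
  ring

lemma isPOVM_blochProj {x : Fin 3} (hx : x ≠ 0) (d : EuclideanSpace ℝ (Fin 3)) :
    IsPOVM (twoOutcome x (blochProj d)) :=
  isPOVM_twoOutcome hx (blochProj_posSemidef d) (one_sub_blochProj' d ▸ blochProj_posSemidef _)

/-- Always guessing `x` has value equal to the prior of `x` and `tr[ρ₀M₀] = 0`, so it cannot be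
optimal. -/
lemma lt_pbarOpt_of_zero_notMem {x : Fin 3} (hx : x ≠ 0) (h : (0 : ℝ) ∉ E.PI q) :
    E.weight q x < E.pbarOpt q := by
  have hN : IsPOVM (twoOutcome x 0) := isPOVM_twoOutcome hx PosSemidef.zero (by simpa using PosSemidef.one)
  have hv := pbarCor_twoOutcome (E := E) (q := q) hx 0
  simp only [mul_zero, trace_zero, Complex.zero_re, add_zero] at hv
  by_contra! hle
  exact h ⟨_, isOptimal_of_le hN (hv ▸ hle), by simp [twoOutcome]⟩

lemma lt_pbarOpt_of_one_notMem (h : (1 : ℝ) ∉ E.PI q) : q < E.pbarOpt q := by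
  have hv : E.pbarCor q ![1, 0, 0] = q := by
    rw [pbarCor_expand]; simp [E.ρ₀_trace]
  by_contra! hle
  exact h ⟨_, isOptimal_of_le isPOVM_trivial (hv.symm ▸ hle), by simp [E.ρ₀_trace]⟩

/-- With `α = tr M₀` and `b` the Bloch vector of `M₀`, positivity of `M₀` and `1 - M₀` gives `‖b‖ ≤
min(α, 2 - α)`. The value is therefore bounded by a function linear on `[0,1]` and on `[1,2]`, equal
to the prior of `x` at `0`, to the value of the Bloch projection at `1`, and to `q` at `2`. Both end
values lie strictly below the optimum, so the middle one must reach it. -/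
lemma blochProj_isOptimal {x y : Fin 3} (hxy : (x = 1 ∧ y = 2) ∨ (x = 2 ∧ y = 1))
    (h0 : (0 : ℝ) ∉ E.PI q) (h1 : (1 : ℝ) ∉ E.PI q) {M : Fin 3 → QubitOp}
    (hM : E.IsOptimal q M) (hy : M y = 0) :
    E.IsOptimal q (twoOutcome x (blochProj (E.blochDiff q x))) := by
  have hx : x ≠ 0 := by rcases hxy with ⟨rfl, -⟩ | ⟨rfl, -⟩ <;> decide
  refine isOptimal_of_le (isPOVM_blochProj hx _) ?_
  have hle := pbarCor_le (E := E) (q := q) (isPOVM_blochProj hx (E.blochDiff q x))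
  rw [pbarCor_blochProj hx] at hle ⊢
  have hval := hM.2
  rw [eq_twoOutcome hxy hM.1 hy, pbarCor_twoOutcome hx,
    trace_wdiff_mul (hM.1.1 0).isHermitian] at hval
  have hq := lt_pbarOpt_of_one_notMem h1
  have hqx := lt_pbarOpt_of_zero_notMem hx h0
  have hin := (real_inner_le_norm (bloch (M 0)) (E.blochDiff q x))
  have hn1 := norm_bloch_le_trace (hM.1.1 0)
  have hn2 := norm_bloch_le_trace (IsPOVM.one_sub_posSemidef hM.1 0)
  have hb : bloch (1 - M 0) = -bloch (M 0) := by
    obtain ⟨a0, a1, a2⟩ := bloch_apply (M 0)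
    obtain ⟨b0, b1, b2⟩ := bloch_apply (1 - M 0)
    ext j
    fin_cases j
    · simp only [Fin.zero_eta, PiLp.neg_apply, a0, b0]; simp; ring
    · simp only [Fin.mk_one, PiLp.neg_apply, a1, b1]; simp; ring
    · simp only [Fin.reduceFinMk, PiLp.neg_apply, a2, b2]; simp
  have ht : ((1 - M 0).trace).re = 2 - ((M 0).trace).re := by simp
  rw [hb, norm_neg, ht] at hn2
  set α := ((M 0).trace).re
  set δ := ‖E.blochDiff q x‖
  have hδ : 0 ≤ δ := norm_nonneg _
  by_contra! hlt
  rcases le_total α 1 with hα | hα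
  · have hα0 : 0 ≤ α := (norm_nonneg _).trans hn1
    have : inner ℝ (bloch (M 0)) (E.blochDiff q x) ≤ α * δ :=
      hin.trans (mul_le_mul_of_nonneg_right hn1 hδ)
    rcases hα0.eq_or_lt with h | h
    · rw [← h] at this hval
      linarith
    · nlinarith [mul_lt_mul_of_pos_left hlt h, mul_nonneg (sub_nonneg.mpr hα) (sub_nonneg.mpr hqx.le)]
  · have hα0 : 0 ≤ 2 - α := (norm_nonneg _).trans hn2
    have : inner ℝ (bloch (M 0)) (E.blochDiff q x) ≤ (2 - α) * δ :=
      hin.trans (mul_le_mul_of_nonneg_right hn2 hδ)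
    rcases hα0.eq_or_lt with h | h
    · rw [← h] at this
      have : α = 2 := by linarith
      rw [this] at hval
      linarith
    · nlinarith [mul_lt_mul_of_pos_left hlt h, mul_nonneg (sub_nonneg.mpr hα) (sub_nonneg.mpr hq.le)]

/-- The optimal POVM with a vanishing outcome. -/
lemma optimal_of_eq_zero (huniq : ∀ M N, E.IsOptimal q M → E.IsOptimal q N → M = N)
    (h0 : (0 : ℝ) ∉ E.PI q) (h1 : (1 : ℝ) ∉ E.PI q) {M : Fin 3 → QubitOp}
    (hM : E.IsOptimal q M) (x y : Fin 3) (hxy : (x = 1 ∧ y = 2) ∨ (x = 2 ∧ y = 1))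
    (hy : M y = 0) :
    E.weight q y + ‖E.blochDiff q y‖ < E.weight q x + ‖E.blochDiff q x‖ ∧
    E.pbarOpt q = 1 / 2 * (q + E.weight q x + ‖E.blochDiff q x‖) ∧
    E.PI q = {1 / 2 * (1 + inner ℝ (E.blochDiff q x) (bloch E.ρ₀) / ‖E.blochDiff q x‖)} ∧
    M 0 = (1 / 2 : ℂ) • (1 + dotPauli (‖E.blochDiff q x‖⁻¹ • E.blochDiff q x)) ∧
    M x = (1 / 2 : ℂ) • (1 + dotPauli (‖E.blochDiff q x‖⁻¹ • (-E.blochDiff q x))) := by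
  have hx : x ≠ 0 := by rcases hxy with ⟨rfl, -⟩ | ⟨rfl, -⟩ <;> decide
  have hy0 : y ≠ 0 := by rcases hxy with ⟨-, rfl⟩ | ⟨-, rfl⟩ <;> decide
  have hopt := blochProj_isOptimal hxy h0 h1 hM hy
  obtain rfl := huniq M _ hM hopt
  have hval := hopt.2
  rw [pbarCor_blochProj hx] at hval
  refine ⟨?_, hval.symm, ?_, by simp [twoOutcome, blochProj], ?_⟩
  -- Otherwise the analogous measurement for `y` would also be optimal, hence equal to `M`; but its
  -- outcome `y` has trace one and `M y = 0`.
  · by_contra! hle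
    have h2 : E.IsOptimal q (twoOutcome y (blochProj (E.blochDiff q y))) := by
      refine isOptimal_of_le (isPOVM_blochProj hy0 _) ?_
      rw [pbarCor_blochProj hy0]
      linarith
    have h3 := congrFun (huniq _ _ hopt h2) y
    rw [hy, twoOutcome_self hy0, one_sub_blochProj'] at h3
    have := trace_blochProj (-(E.blochDiff q y))
    rw [← h3] at this
    simp at this
  · have hp : ((E.ρ₀ * twoOutcome x (blochProj (E.blochDiff q x)) 0).trace).re
        = 1 / 2 * (1 + inner ℝ (E.blochDiff q x) (bloch E.ρ₀) / ‖E.blochDiff q x‖) := by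
      simp only [twoOutcome, if_true]
      rw [trace_mul_blochProj, E.ρ₀_trace, real_inner_smul_left, Complex.one_re]
      ring
    ext Q
    refine ⟨?_, fun hQ => ⟨_, hopt, hp.trans hQ.symm⟩⟩
    rintro ⟨N, hN, rfl⟩
    rw [huniq N _ hN hopt]
    exact hp
  · rw [twoOutcome_self hx, one_sub_blochProj]

end QubitEnsemble

/-! ### Scalar identities for the coefficients, `λ₁` and `λ₂`. -/

/-- The coefficient of the measurement operator `M₀` with respect to the rank-one operator
spanning the kernel of its Lagrange slack. -/
noncomputable def coeff₀ (q C₁ C₂ a b r : ℝ) : ℝ :=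
  (1 - 2 * a * C₁ - 2 * b * C₂
      + r * (2 * C₁ - 1) * (2 * C₂ - 1)
          * ((C₁ - q) * (C₂ - q) + (q - 1 + C₁) * (q - 1 + C₂)) / etaRoot q C₁ C₂)
    / ((2 * q - 1) * (C₁ + C₂ - 1))

/-- The coefficient of the measurement operator `M₁`. -/
noncomputable def coeff₁ (q C₁ C₂ a b r : ℝ) : ℝ :=
  (a * (q - 1 + C₁) + b * (C₂ - q)
      - r * (C₂ - q) * (q - 1 + C₁)
          * ((2 * C₁ - 1) * (q - 1 + C₂) + (2 * C₂ - 1) * (C₁ - q)) / etaRoot q C₁ C₂)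
    / ((2 * q - 1) * (C₁ + C₂ - 1))

/-- The coefficient of the measurement operator `M₂`. -/
noncomputable def coeff₂ (q C₁ C₂ a b r : ℝ) : ℝ :=
  (a * (C₁ - q) + b * (q - 1 + C₂)
      - r * (C₁ - q) * (q - 1 + C₂)
          * ((2 * C₂ - 1) * (q - 1 + C₁) + (2 * C₁ - 1) * (C₂ - q)) / etaRoot q C₁ C₂)
    / ((2 * q - 1) * (C₁ + C₂ - 1))

section Scalars

variable {q C₁ C₂ a b r : ℝ}

lemma lam_add (hu : 2 * q - 1 ≠ 0) (hC : C₁ + C₂ - 1 ≠ 0) :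
    lam₁ q C₁ C₂ + lam₂ q C₁ C₂
      = ((2 * C₁ - 1) * (2 * C₂ - 1) - (2 * q - 1) ^ 2) / (2 * (2 * q - 1)) := by
  unfold lam₁ lam₂; field_simp; ring

/-- `λ₁ + λ₂` is the trace of the rank-one operator that `coeff₀` multiplies, so `η₀` is `tr[ρ₀M₀]`.
The next two lemmas do the same for outcomes 1 and 2. -/
lemma eta₀_eq (hu : 2 * q - 1 ≠ 0) (hC : C₁ + C₂ - 1 ≠ 0) :
    eta₀ q C₁ C₂ a b r = coeff₀ q C₁ C₂ a b r * (lam₁ q C₁ C₂ + lam₂ q C₁ C₂) := by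
  rw [lam_add hu hC, eta₀, coeff₀]
  generalize etaRoot q C₁ C₂ = R
  simp only [mul_div_assoc]
  field_simp

lemma eta₁_eq (hu : 2 * q - 1 ≠ 0) (hC : C₁ + C₂ - 1 ≠ 0) :
    eta₁ q C₁ C₂ a b r
      = coeff₁ q C₁ C₂ a b r * (lam₁ q C₁ C₂ + lam₂ q C₁ C₂ + 2 * q - 1 - C₁ + C₂) := by
  rw [lam_add hu hC, eta₁, coeff₁]
  have h : ((2 * C₁ - 1) * (2 * C₂ - 1) - (2 * q - 1) ^ 2) / (2 * (2 * q - 1)) + 2 * q - 1 - C₁ + C₂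
      = ((2 * C₁ - 1) * (2 * C₂ - 1) + 2 * (C₂ - C₁) * (2 * q - 1) + (2 * q - 1) ^ 2)
        / (2 * (2 * q - 1)) := by field_simp; ring
  rw [h]
  generalize etaRoot q C₁ C₂ = R
  simp only [mul_div_assoc]
  field_simp

lemma eta₂_eq (hu : 2 * q - 1 ≠ 0) (hC : C₁ + C₂ - 1 ≠ 0) :
    eta₂ q C₁ C₂ a b r
      = coeff₂ q C₁ C₂ a b r * (lam₁ q C₁ C₂ + lam₂ q C₁ C₂ + 2 * q - 1 + C₁ - C₂) := by
  rw [lam_add hu hC, eta₂, coeff₂]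
  have h : ((2 * C₁ - 1) * (2 * C₂ - 1) - (2 * q - 1) ^ 2) / (2 * (2 * q - 1)) + 2 * q - 1 + C₁ - C₂
      = ((2 * C₁ - 1) * (2 * C₂ - 1) - 2 * (C₂ - C₁) * (2 * q - 1) + (2 * q - 1) ^ 2)
        / (2 * (2 * q - 1)) := by field_simp; ring
  rw [h]
  generalize etaRoot q C₁ C₂ = R
  simp only [mul_div_assoc]
  field_simp

lemma sqrt_lam_mul (hu : 0 < 2 * q - 1) (hC : 0 < C₁ + C₂ - 1) :
    etaRoot q C₁ C₂
      = Real.sqrt (lam₁ q C₁ C₂ * lam₂ q C₁ C₂) * ((2 * q - 1) * (C₁ + C₂ - 1)) := by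
  have hD : 0 < (2 * q - 1) * (C₁ + C₂ - 1) := mul_pos hu hC
  have h : (2 * C₁ - 1) * (2 * C₂ - 1) * (C₁ - q) * (C₂ - q) * (q - 1 + C₁) * (q - 1 + C₂)
      = lam₁ q C₁ C₂ * lam₂ q C₁ C₂ * ((2 * q - 1) * (C₁ + C₂ - 1)) ^ 2 := by
    unfold lam₁ lam₂; field_simp
  rw [etaRoot, h, Real.sqrt_mul' _ (sq_nonneg _), Real.sqrt_sq hD.le]

/-- The completeness relation read entrywise: the off-diagonal entry fixes the sum of the
coefficients, and the diagonal entries are `a = ρ₁₁` and `b = ρ₂₂`. -/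
lemma coeff_system {s : ℝ} (hs : s ≠ 0) (hu : 2 * q - 1 ≠ 0) (hC : C₁ + C₂ - 1 ≠ 0)
    (hR : etaRoot q C₁ C₂ = s * ((2 * q - 1) * (C₁ + C₂ - 1))) (hab : a + b = 1) :
    coeff₀ q C₁ C₂ a b r + coeff₁ q C₁ C₂ a b r + coeff₂ q C₁ C₂ a b r = r / s ∧
    lam₂ q C₁ C₂ * (r / s) + coeff₁ q C₁ C₂ a b r * (q - 1 + C₂)
      + coeff₂ q C₁ C₂ a b r * (q - C₂) = a ∧
    lam₁ q C₁ C₂ * (r / s) + coeff₁ q C₁ C₂ a b r * (q - C₁)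
      + coeff₂ q C₁ C₂ a b r * (q - 1 + C₁) = b := by
  obtain rfl : b = 1 - a := by linarith
  unfold coeff₀ coeff₁ coeff₂ lam₁ lam₂
  rw [hR]
  refine ⟨?_, ?_, ?_⟩ <;> field_simp <;> ring

/-- Once the sum of the coefficients is fixed, the equations for `m 1` and `m 2` have determinant
`(q-1+C₁)(q-1+C₂) - (q-C₁)(q-C₂) = (2q-1)(C₁+C₂-1)`. -/
lemma system_unique {m m' : Fin 3 → ℝ} {x y t : ℝ} (hu : 2 * q - 1 ≠ 0) (hC : C₁ + C₂ - 1 ≠ 0)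
    (h₀ : m 0 + m 1 + m 2 = t) (h₀' : m' 0 + m' 1 + m' 2 = t)
    (h₁ : y * t + m 1 * (q - 1 + C₂) + m 2 * (q - C₂) = a)
    (h₁' : y * t + m' 1 * (q - 1 + C₂) + m' 2 * (q - C₂) = a)
    (h₂ : x * t + m 1 * (q - C₁) + m 2 * (q - 1 + C₁) = b)
    (h₂' : x * t + m' 1 * (q - C₁) + m' 2 * (q - 1 + C₁) = b) : m = m' := by
  have hD : (2 * q - 1) * (C₁ + C₂ - 1) ≠ 0 := mul_ne_zero hu hC
  have e₁ : m 1 = m' 1 := by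
    apply mul_left_cancel₀ hD
    linear_combination (q - 1 + C₁) * (h₁ - h₁') - (q - C₂) * (h₂ - h₂')
  have e₂ : m 2 = m' 2 := by
    apply mul_left_cancel₀ hD
    linear_combination (q - 1 + C₂) * (h₂ - h₂') - (q - C₁) * (h₁ - h₁')
  have e₀ : m 0 = m' 0 := by linarith
  funext i
  fin_cases i
  · exact e₀
  · exact e₁
  · exact e₂

/-- Subtracting `h₀` from the other two equations cancels the product `xy`. What is left is linear
in `x, y`, and Cramer's rule gives `λ₁, λ₂`. -/
lemma eq_lam_of_det {x y n : ℝ} (hu : 2 * q - 1 ≠ 0) (hC : C₁ + C₂ - 1 ≠ 0)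
    (h₀ : x * y = n) (h₁ : (x + (q - C₁)) * (y + (q - 1 + C₂)) = n)
    (h₂ : (x + (q - 1 + C₁)) * (y + (q - C₂)) = n) :
    x = lam₁ q C₁ C₂ ∧ y = lam₂ q C₁ C₂ := by
  have hD : (2 * q - 1) * (C₁ + C₂ - 1) ≠ 0 := mul_ne_zero hu hC
  constructor
  · rw [lam₁, eq_div_iff hD]
    linear_combination (q - 1 + C₁) * (h₁ - h₀) - (q - C₁) * (h₂ - h₀)
  · rw [lam₂, eq_div_iff hD]
    linear_combination (q - 1 + C₂) * (h₂ - h₀) - (q - C₂) * (h₁ - h₀)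

lemma lam_det (hu : 2 * q - 1 ≠ 0) (hC : C₁ + C₂ - 1 ≠ 0) :
    (lam₁ q C₁ C₂ + (q - C₁)) * (lam₂ q C₁ C₂ + (q - 1 + C₂)) = lam₁ q C₁ C₂ * lam₂ q C₁ C₂ ∧
    (lam₁ q C₁ C₂ + (q - 1 + C₁)) * (lam₂ q C₁ C₂ + (q - C₂)) = lam₁ q C₁ C₂ * lam₂ q C₁ C₂ := by
  unfold lam₁ lam₂
  constructor <;> field_simp <;> ring

/-- If `λ₁, λ₂ ≥ 0` and `η₀ > 0`, then `q < C₁`. -/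
lemma lt_C₁_of_eta₀_pos (hu : 0 < 2 * q - 1) (hC : 0 < C₁ + C₂ - 1) (hq : q < C₂)
    (hb : 0 ≤ b) (hab : a + b = 1) (h₁ : 0 ≤ lam₁ q C₁ C₂) (h₂ : 0 ≤ lam₂ q C₁ C₂)
    (h : 0 < eta₀ q C₁ C₂ a b r) : q < C₁ := by
  have hD : 0 < (2 * q - 1) * (C₁ + C₂ - 1) := mul_pos hu hC
  rw [lam₁, le_div_iff₀ hD, zero_mul] at h₁
  rw [lam₂, le_div_iff₀ hD, zero_mul] at h₂
  have hc1 : 0 ≤ 2 * C₁ - 1 := by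
    by_contra! hneg
    nlinarith [mul_pos (sub_pos.mpr hq) (by linarith : 0 < q - 1 + C₂)]
  have hle : q ≤ C₁ := by
    by_contra! hlt
    nlinarith [mul_pos (mul_pos (by linarith : 0 < 2 * C₂ - 1) (sub_pos.mpr hlt))
      (by linarith : 0 < q - 1 + C₁)]
  refine lt_of_le_of_ne hle ?_
  rintro rfl
  -- In the boundary case `q = C₁` the term over `R = 0` is read as `0`, and the remaining bracket
  -- is at most `1 - 2q < 0`.
  have hR : etaRoot q q C₂ = 0 := by simp [etaRoot]
  rw [eta₀, hR, div_zero, add_zero] at h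
  have hneg : 1 - 2 * a * q - 2 * b * C₂ ≤ 0 := by nlinarith
  refine absurd h (not_lt.mpr (mul_nonpos_of_nonneg_of_nonpos ?_ hneg))
  apply div_nonneg
  · nlinarith
  · positivity

lemma lam_pos (hu : 0 < 2 * q - 1) (h₁ : q < C₁) (h₂ : q < C₂) :
    0 < lam₁ q C₁ C₂ ∧ 0 < lam₂ q C₁ C₂ := by
  have hC : 0 < C₁ + C₂ - 1 := by linarith
  refine ⟨div_pos ?_ (mul_pos hu hC), div_pos ?_ (mul_pos hu hC)⟩
  · exact mul_pos (mul_pos (by linarith) (by linarith)) (by linarith)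
  · exact mul_pos (mul_pos (by linarith) (by linarith)) (by linarith)

lemma lam_trace_pos (hu : 0 < 2 * q - 1) (h₁ : q < C₁) (h₂ : q < C₂) (hle : C₁ ≤ C₂) :
    0 < lam₁ q C₁ C₂ + lam₂ q C₁ C₂ + 2 * q - 1 - C₁ + C₂ ∧
    0 < lam₁ q C₁ C₂ + lam₂ q C₁ C₂ + 2 * q - 1 + C₁ - C₂ := by
  have h := lam_pos hu h₁ h₂
  refine ⟨by linarith [h.1, h.2], ?_⟩
  rw [lam_add hu.ne' (by linarith)]
  have e : ((2 * C₁ - 1) * (2 * C₂ - 1) - (2 * q - 1) ^ 2) / (2 * (2 * q - 1)) + 2 * q - 1 + C₁ - C₂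
      = ((2 * C₁ - 1) * (2 * C₂ - 1 + (2 * q - 1)) - (2 * q - 1) * (2 * C₂ - 1 - (2 * q - 1)))
        / (2 * (2 * q - 1)) := by field_simp; ring
  rw [e]
  refine div_pos ?_ (by positivity)
  -- With `u = 2q - 1 < 2C₁ - 1`, the numerator exceeds `u(2C₂-1+u) - u(2C₂-1-u) = 2u²`.
  nlinarith [mul_pos (sub_pos.mpr h₁) (by linarith : 0 < 2 * C₂ - 1 + (2 * q - 1)), mul_pos hu hu]

end Scalars

/-! ### Singular positive semidefinite two-by-two matrices. -/

/-- A nonzero `M` forces `B` to be singular, and `B ≠ 0` then has a one-dimensional kernel, spanned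
by the range of its adjugate. If `B` is invertible, `m = 0`. -/
lemma exists_eq_smul_of_mul_eq_zero {B M : QubitOp} (hB : B.PosSemidef) (hM : M.PosSemidef)
    (hBM : B * M = 0) (hw : B 0 1 ≠ 0) :
    ∃ m : ℝ, 0 ≤ m ∧ M = (m : ℂ) • !![B 1 1, -B 0 1; -B 1 0, B 0 0] ∧
      (M ≠ 0 → B 0 0 * B 1 1 = B 0 1 * B 1 0) := by
  have hB10 : B 1 0 = star (B 0 1) := (hB.isHermitian.apply 1 0).symm
  have hM10 : M 1 0 = star (M 0 1) := (hM.isHermitian.apply 1 0).symm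
  have hre : ∀ {A : QubitOp}, A.PosSemidef → ∀ j, A j j = ((A j j).re : ℂ) ∧ 0 ≤ (A j j).re :=
    fun hA j => ⟨Complex.ext rfl (Complex.le_def.mp hA.diag_nonneg).2.symm,
      (Complex.le_def.mp hA.diag_nonneg).1⟩
  have hx : B 0 0 ≠ 0 := fun h0 => by
    have hd := hB.det_nonneg
    rw [det_fin_two, h0, zero_mul, zero_sub, hB10, Complex.star_def, Complex.mul_conj] at hd
    have := (Complex.le_def.mp hd).1
    simp only [Complex.zero_re, Complex.neg_re, Complex.ofReal_re] at this
    exact hw (Complex.normSq_eq_zero.mp (le_antisymm (by linarith) (Complex.normSq_nonneg _)))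
  have e00 := congrFun (congrFun hBM 0) 0
  have e01 := congrFun (congrFun hBM 0) 1
  have e10 := congrFun (congrFun hBM 1) 0
  have e11 := congrFun (congrFun hBM 1) 1
  simp only [mul_apply, Fin.sum_univ_two, Matrix.zero_apply] at e00 e01 e10 e11
  -- The factor is read off the lower right entry, where the adjugate has `B 0 0 ≠ 0`.
  set m : ℝ := (M 1 1).re / (B 0 0).re with hm
  have hmc : (m : ℂ) * B 0 0 = M 1 1 := by
    rw [(hre hB 0).1, (hre hM 1).1, ← Complex.ofReal_mul, hm, div_mul_cancel₀]
    intro h0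
    exact hx (by rw [(hre hB 0).1, h0]; rfl)
  have m01 : M 0 1 = (m : ℂ) * -B 0 1 := by
    apply mul_left_cancel₀ hx
    linear_combination e01 + B 0 1 * hmc
  have m10 : M 1 0 = (m : ℂ) * -B 1 0 := by
    rw [hM10, m01, hB10]; simp
  have m00 : M 0 0 = (m : ℂ) * B 1 1 := by
    apply mul_left_cancel₀ hx
    linear_combination e00 - B 0 1 * m10 - e11 - B 1 1 * hmc + B 1 0 * m01
  refine ⟨m, div_nonneg (hre hM 1).2 (hre hB 0).2, ?_, fun hM0 => ?_⟩
  · ext i j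
    fin_cases i <;> fin_cases j <;> simp [m00, m01, m10, ← hmc]
  · have hm0 : (m : ℂ) ≠ 0 := fun h0 => hM0 <| by
      ext i j
      fin_cases i <;> fin_cases j <;> simp [m00, m01, m10, ← hmc, h0]
    apply mul_left_cancel₀ hm0
    linear_combination e11 + B 1 1 * hmc - B 1 0 * m01

/-- By Cayley–Hamilton a matrix `A` of determinant zero satisfies `A² = (tr A) A`, so a Hermitian
one of positive trace is a positive multiple of `AᴴA`. -/
lemma posSemidef_of_det_eq_zero {x y : ℝ} {w : ℂ} (hx : 0 < x + y)
    (h : x * y = Complex.normSq w) : (!![(x : ℂ), w; star w, (y : ℂ)] : QubitOp).PosSemidef := by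
  have hsq : (!![(x : ℂ), w; star w, (y : ℂ)] : QubitOp)
      * !![(x : ℂ), w; star w, (y : ℂ)] = ((x + y : ℝ) : ℂ) • !![(x : ℂ), w; star w, (y : ℂ)] := by
    have hc : (x : ℂ) * y = w * star w := by
      rw [Complex.star_def, Complex.mul_conj, ← h]; push_cast; rfl
    ext i j
    fin_cases i <;> fin_cases j <;>
      simp only [mul_apply, Fin.sum_univ_two, Matrix.smul_apply, smul_eq_mul, of_apply, cons_val',
        cons_val_zero, cons_val_one, cons_val_fin_one, Fin.zero_eta, Fin.mk_one, Fin.isValue,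
        Complex.ofReal_add]
    · linear_combination -hc
    · ring
    · ring
    · linear_combination -hc
  have hH : (!![(x : ℂ), w; star w, (y : ℂ)] : QubitOp)ᴴ = !![(x : ℂ), w; star w, (y : ℂ)] := by
    ext i j
    fin_cases i <;> fin_cases j <;> simp
  have h1 := posSemidef_conjTranspose_mul_self (!![(x : ℂ), w; star w, (y : ℂ)] : QubitOp)
  rw [hH, hsq] at h1
  have h2 := h1.smul (Complex.zero_le_real.mpr (inv_nonneg.mpr hx.le))
  rwa [smul_smul, ← Complex.ofReal_mul, inv_mul_cancel₀ hx.ne', Complex.ofReal_one, one_smul] at h2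

lemma lt_C₁_of_lam_pos {q C₁ C₂ : ℝ} (hu : 0 < 2 * q - 1) (hC : 0 < C₁ + C₂ - 1) (hq : q < C₂)
    (h₁ : 0 < lam₁ q C₁ C₂) (h₂ : 0 < lam₂ q C₁ C₂) : q < C₁ := by
  have hD : 0 < (2 * q - 1) * (C₁ + C₂ - 1) := mul_pos hu hC
  rw [lam₁, lt_div_iff₀ hD, zero_mul] at h₁
  rw [lam₂, lt_div_iff₀ hD, zero_mul] at h₂
  have hc1 : 0 < 2 * C₁ - 1 := by
    by_contra! hneg
    nlinarith [mul_pos (sub_pos.mpr hq) (by linarith : 0 < q - 1 + C₂)]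
  by_contra! hlt
  nlinarith [mul_nonneg (mul_nonneg (by linarith : 0 ≤ 2 * C₂ - 1) (sub_nonneg.mpr hlt))
    (by linarith : 0 ≤ q - 1 + C₁)]

/-! ### The eigenbasis frame and the slacks of a Lagrange operator. -/

namespace QubitEnsemble

/-- Matrices `T`, `V` that translate a qubit ensemble to the eigenbasis `ν₁, ν₂` of the operators
`ρ̄₁, ρ̄₂`: measurement operators become `Tᴴ M T` and weighted states become `Vᴴ A V`. -/
structure IsFrame (E : QubitEnsemble) (ν₁ ν₂ : Fin 2 → ℂ) (T V : QubitOp) : Prop where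
  mul₁ : V * Tᴴ = 1
  conj_one : Vᴴ * ((E.q₁ : ℂ) • E.ρ₁) * V = !![(E.C₁ : ℂ), 0; 0, 1 - (E.C₂ : ℂ)]
  conj_two : Vᴴ * ((E.q₂ : ℂ) • E.ρ₂) * V = !![1 - (E.C₁ : ℂ), 0; 0, (E.C₂ : ℂ)]
  conj_zero : Vᴴ * E.ρ₀ * V = 1
  gram : Tᴴ * T = !![E.entry ν₁ ν₁, E.entry ν₁ ν₂; E.entry ν₂ ν₁, E.entry ν₂ ν₂]
  bar : ∀ (M : QubitOp) (s x : ℝ) (z w : ℂ) (y : ℝ),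
    Tᴴ * M * T = (s : ℂ) • !![(x : ℂ), z; w, (y : ℂ)] → E.bar M = opInBasis ν₁ ν₂ s x z w y

lemma exists_isFrame {E : QubitEnsemble} (hC : 1 < E.C₁ + E.C₂) {ν₁ ν₂ : Fin 2 → ℂ}
    (hν₁ : IsUnitEigenvector E.barState₁ E.C₁ ν₁) (hν₂ : IsUnitEigenvector E.barState₂ E.C₂ ν₂) :
    ∃ T V, E.IsFrame ν₁ ν₂ T V := by
  have hb2 : E.barState₂ = 1 - E.barState₁ := by rw [← E.barState_add]; simp
  have hν₂' : E.barState₁ *ᵥ ν₂ = (1 - E.C₂ : ℂ) • ν₂ := by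
    have h := hν₂.2
    rw [hb2, sub_mulVec, one_mulVec] at h
    rw [sub_smul, one_smul, ← h]; simp
  have hν₁' : E.barState₂ *ᵥ ν₁ = (1 - E.C₁ : ℂ) • ν₁ := by
    rw [hb2, sub_mulVec, one_mulVec, hν₁.2, sub_smul, one_smul]
  -- `ν₁` and `ν₂` are eigenvectors of the same operator `ρ̄₁`, for the eigenvalues `C₁` and `1 -
  -- C₂`, which differ because `C₁ + C₂ > 1`.
  have horth : star ν₂ ⬝ᵥ ν₁ = 0 := by
    have h1 : star ν₂ ⬝ᵥ (E.barState₁ *ᵥ ν₁) = (1 - E.C₂ : ℂ) * (star ν₂ ⬝ᵥ ν₁) := by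
      rw [dotProduct_mulVec, ← E.barState₁_posSemidef.isHermitian.eq, ← star_mulVec, hν₂',
        star_smul, smul_dotProduct]
      simp
    rw [hν₁.2, dotProduct_smul, smul_eq_mul] at h1
    have h2 : ((E.C₁ + E.C₂ - 1 : ℝ) : ℂ) * (star ν₂ ⬝ᵥ ν₁) = 0 := by
      push_cast; linear_combination h1
    exact (mul_eq_zero.mp h2).resolve_left (by exact_mod_cast (by linarith : E.C₁ + E.C₂ - 1 ≠ 0))
  have horth' : star ν₁ ⬝ᵥ ν₂ = 0 := by
    rw [star_dotProduct, horth, star_zero]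
  set U : QubitOp := (of ![ν₁, ν₂])ᵀ with hU
  have hUcol : ∀ A : QubitOp, Uᴴ * A * U = !![star ν₁ ⬝ᵥ (A *ᵥ ν₁), star ν₁ ⬝ᵥ (A *ᵥ ν₂);
      star ν₂ ⬝ᵥ (A *ᵥ ν₁), star ν₂ ⬝ᵥ (A *ᵥ ν₂)] := fun A => by
    rw [Matrix.mul_assoc]
    ext i j
    fin_cases i <;> fin_cases j <;>
      simp [hU, mul_apply, dotProduct, mulVec, Fin.sum_univ_two]
  have hUU : Uᴴ * U = 1 := by
    have h := hUcol 1
    rw [Matrix.mul_one] at h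
    rw [h, one_mulVec, one_mulVec, hν₁.1, hν₂.1, horth, horth', one_fin_two]
  have hUU' : U * Uᴴ = 1 := mul_eq_one_comm.mp hUU
  have hS := E.rootAvg_isUnit_det
  -- With `U` the unitary with columns `ν₁, ν₂`: `T = ρ₀^{1/2}U` and `V = ρ₀^{-1/2}U`. The two
  -- congruences are dual to each other and preserve `tr(AM)`.
  refine ⟨E.rootAvg * U, E.rootAvg⁻¹ * U, ?_, ?_, ?_, ?_, ?_, ?_⟩
  · rw [conjTranspose_mul, rootAvg_isHermitian, Matrix.mul_assoc, ← Matrix.mul_assoc U, hUU',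
      Matrix.one_mul, nonsing_inv_mul _ hS]
  · have h := hUcol E.barState₁
    rw [hν₁.2, hν₂'] at h
    simp only [dotProduct_smul, hν₁.1, hν₂.1, horth, horth', smul_eq_mul, mul_one, mul_zero] at h
    rw [← h, conjTranspose_mul, rootAvg_inv_isHermitian, barState₁]
    simp only [Matrix.mul_assoc]
  · have h := hUcol E.barState₂
    rw [hν₂.2, hν₁'] at h
    simp only [dotProduct_smul, hν₁.1, hν₂.1, horth, horth', smul_eq_mul, mul_one, mul_zero] at h
    rw [← h, conjTranspose_mul, rootAvg_inv_isHermitian, barState₂]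
    simp only [Matrix.mul_assoc]
  · have h := E.inv_mul_ρ₀_mul_inv
    rw [conjTranspose_mul, rootAvg_inv_isHermitian]
    calc Uᴴ * E.rootAvg⁻¹ * E.ρ₀ * (E.rootAvg⁻¹ * U)
        = Uᴴ * (E.rootAvg⁻¹ * E.ρ₀ * E.rootAvg⁻¹) * U := by simp only [Matrix.mul_assoc]
      _ = 1 := by rw [h, Matrix.mul_one, hUU]
  · have h := hUcol E.ρ₀
    rw [conjTranspose_mul, rootAvg_isHermitian]
    calc Uᴴ * E.rootAvg * (E.rootAvg * U) = Uᴴ * (E.rootAvg * E.rootAvg) * U := by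
          simp only [Matrix.mul_assoc]
      _ = _ := by rw [rootAvg_sq, h]; rfl
  · intro M s x z w y h
    have h1 : U * ((s : ℂ) • !![(x : ℂ), z; w, (y : ℂ)]) * Uᴴ = E.bar M := by
      rw [← h, conjTranspose_mul, rootAvg_isHermitian, QubitEnsemble.bar]
      calc U * (Uᴴ * E.rootAvg * M * (E.rootAvg * U)) * Uᴴ
          = (U * Uᴴ) * E.rootAvg * M * E.rootAvg * (U * Uᴴ) := by simp only [Matrix.mul_assoc]
        _ = _ := by rw [hUU', Matrix.one_mul, Matrix.mul_one]
    rw [← h1, opInBasis, mul_smul_comm, smul_mul_assoc]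
    congr 1
    ext i j
    simp [hU, ketbra, mul_apply, vecMulVec_apply, Fin.sum_univ_two]
    ring

variable {E : QubitEnsemble} {ν₁ ν₂ : Fin 2 → ℂ} {T V : QubitOp}

lemma entry_star (E : QubitEnsemble) (u v : Fin 2 → ℂ) : star (E.entry u v) = E.entry v u := by
  rw [entry, entry, ← star_dotProduct, star_mulVec, E.ρ₀_posDef.isHermitian.eq, dotProduct_mulVec]

lemma entry_self (E : QubitEnsemble) (u : Fin 2 → ℂ) :
    E.entry u u = ((E.entry u u).re : ℂ) ∧ 0 ≤ (E.entry u u).re := by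
  have h : 0 ≤ E.entry u u := E.ρ₀_posDef.posSemidef.dotProduct_mulVec_nonneg u
  exact ⟨Complex.ext rfl (Complex.le_def.mp h).2.symm, (Complex.le_def.mp h).1⟩

namespace IsFrame

variable (F : E.IsFrame ν₁ ν₂ T V)
include F

lemma mul₂ : Tᴴ * V = 1 := mul_eq_one_comm.mp F.mul₁

lemma mul₃ : T * Vᴴ = 1 := by
  have h := congrArg conjTranspose F.mul₁
  simpa [conjTranspose_mul] using h

lemma mul₄ : Vᴴ * T = 1 := mul_eq_one_comm.mp F.mul₃

lemma conj_cancel (A : QubitOp) : T * (Vᴴ * A * V) * Tᴴ = A := by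
  calc T * (Vᴴ * A * V) * Tᴴ = (T * Vᴴ) * A * (V * Tᴴ) := by simp only [Matrix.mul_assoc]
    _ = A := by rw [F.mul₃, F.mul₁, Matrix.one_mul, Matrix.mul_one]

lemma conj_cancel' (M : QubitOp) : V * (Tᴴ * M * T) * Vᴴ = M := by
  calc V * (Tᴴ * M * T) * Vᴴ = (V * Tᴴ) * M * (T * Vᴴ) := by simp only [Matrix.mul_assoc]
    _ = M := by rw [F.mul₃, F.mul₁, Matrix.one_mul, Matrix.mul_one]

lemma trace_conj (A M : QubitOp) : (Vᴴ * A * V * (Tᴴ * M * T)).trace = (A * M).trace := by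
  have h : Vᴴ * A * V * (Tᴴ * M * T) = Vᴴ * (A * M * T) := by
    calc Vᴴ * A * V * (Tᴴ * M * T) = Vᴴ * A * (V * Tᴴ) * M * T := by simp only [Matrix.mul_assoc]
      _ = _ := by rw [F.mul₁]; simp only [Matrix.mul_assoc, Matrix.one_mul]
  rw [h, Matrix.trace_mul_comm, Matrix.mul_assoc, F.mul₃, Matrix.mul_one]

lemma conj_mul (A M : QubitOp) : Vᴴ * A * V * (Tᴴ * M * T) = Vᴴ * (A * M) * T := by
  calc Vᴴ * A * V * (Tᴴ * M * T) = Vᴴ * A * (V * Tᴴ) * M * T := by simp only [Matrix.mul_assoc]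
    _ = _ := by rw [F.mul₁]; simp only [Matrix.mul_assoc, Matrix.one_mul]

lemma entry_add : (E.entry ν₁ ν₁).re + (E.entry ν₂ ν₂).re = 1 := by
  have h := F.trace_conj E.ρ₀ 1
  rw [F.conj_zero, Matrix.one_mul, Matrix.mul_one, Matrix.mul_one, F.gram, E.ρ₀_trace,
    trace_fin_two] at h
  simpa using congrArg Complex.re h

end IsFrame

/-- The first diagonal entries of `q I - Aᵢ`, where `Aᵢ` are the weighted states in the
eigenbasis. -/
noncomputable def shift₁ (E : QubitEnsemble) (q : ℝ) : Fin 3 → ℝ := ![0, q - E.C₁, q - 1 + E.C₁]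

/-- The second diagonal entries of `q I - Aᵢ`. -/
noncomputable def shift₂ (E : QubitEnsemble) (q : ℝ) : Fin 3 → ℝ := ![0, q - 1 + E.C₂, q - E.C₂]

lemma IsFrame.conj_wstate (F : E.IsFrame ν₁ ν₂ T V) (q : ℝ) (i : Fin 3) :
    Vᴴ * E.wstate q i * V
      = !![((q - E.shift₁ q i : ℝ) : ℂ), 0; 0, ((q - E.shift₂ q i : ℝ) : ℂ)] := by
  fin_cases i
  · change Vᴴ * ((q : ℂ) • E.ρ₀) * V = _
    rw [mul_smul_comm, smul_mul_assoc, F.conj_zero, one_fin_two]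
    ext i j
    fin_cases i <;> fin_cases j <;> simp [shift₁, shift₂]
  · refine F.conj_one.trans ?_
    ext i j
    fin_cases i <;> fin_cases j <;> simp [shift₁, shift₂]
    ring
  · refine F.conj_two.trans ?_
    ext i j
    fin_cases i <;> fin_cases j <;> simp [shift₁, shift₂]
    ring

/-- The slack `L - Aᵢ` of the Lagrange operator in the eigenbasis. -/
noncomputable def slack (E : QubitEnsemble) (q x y : ℝ) (w : ℂ) (i : Fin 3) : QubitOp :=
  !![((x + E.shift₁ q i : ℝ) : ℂ), w; star w, ((y + E.shift₂ q i : ℝ) : ℂ)]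

/-- The adjugate of the slack. -/
noncomputable def coslack (E : QubitEnsemble) (q x y : ℝ) (w : ℂ) (i : Fin 3) : QubitOp :=
  !![((y + E.shift₂ q i : ℝ) : ℂ), -w; -star w, ((x + E.shift₁ q i : ℝ) : ℂ)]

/-- The weighted states are diagonal in the frame, so the slacks of `L` share their off-diagonal
entry `w`; only the diagonal depends on the outcome. -/
lemma IsFrame.exists_slack (F : E.IsFrame ν₁ ν₂ T V) {q : ℝ} {L : QubitOp}
    (hL : E.IsLagrange q L) :
    ∃ (x y : ℝ) (w : ℂ), ∀ i, Vᴴ * (L - E.wstate q i) * V = E.slack q x y w i ∧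
      (E.slack q x y w i).PosSemidef := by
  have hp : ∀ i, (Vᴴ * (L - E.wstate q i) * V).PosSemidef := fun i =>
    (hL.1 i).conjTranspose_mul_mul_same V
  set B := Vᴴ * (L - E.wstate q 0) * V with hB
  have hre : ∀ j, B j j = ((B j j).re : ℂ) := fun j =>
    Complex.ext rfl (Complex.le_def.mp (hp 0).diag_nonneg).2.symm
  have hB10 : B 1 0 = star (B 0 1) := ((hp 0).isHermitian.apply 1 0).symm
  have key : ∀ i, Vᴴ * (L - E.wstate q i) * V
      = E.slack q (B 0 0).re (B 1 1).re (B 0 1) i := fun i => by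
    have h : Vᴴ * (L - E.wstate q i) * V
        = B + Vᴴ * E.wstate q 0 * V - Vᴴ * E.wstate q i * V := by
      rw [hB]; simp only [Matrix.mul_sub, Matrix.sub_mul]; abel
    rw [h, F.conj_wstate, F.conj_wstate]
    ext j k
    fin_cases j <;> fin_cases k
    · simp [slack, shift₁, ← hre]; ring
    · simp [slack]
    · simp [slack, hB10]
    · simp [slack, shift₂, ← hre]; ring
  exact ⟨(B 0 0).re, (B 1 1).re, B 0 1, fun i => ⟨key i, key i ▸ hp i⟩⟩

/-! ### Structure of the optimal POVMs in the intermediate range. -/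

/-- The standing assumptions on the inconclusive degree `q`. -/
structure Intermediate (E : QubitEnsemble) (q : ℝ) : Prop where
  half_lt : 1 / 2 < q
  lt_C₂ : q < E.C₂
  le_C₂ : E.C₁ ≤ E.C₂
  one_lt : 1 < E.C₁ + E.C₂
  zero_notMem : (0 : ℝ) ∉ E.PI q

lemma intermediate_of_lt {q : ℝ} (hC : E.C₁ ≤ E.C₂) (hq₀ : E.qLow < q) (hq₁ : q < E.qHigh) :
    E.Intermediate q where
  half_lt := E.half_le_qLow.trans_lt hq₀
  lt_C₂ := hq₁.trans_le (qHigh_le_C₂ hC)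
  le_C₂ := hC
  one_lt := one_lt_C₁_add_C₂ hC (hq₀.trans hq₁)
  zero_notMem := zero_notMem_PI hq₀

section Core

variable {q x y : ℝ} {w : ℂ} {L : QubitOp}

/-- Positivity of slack 2 gives `y ≥ C₂ - q > 0`, which excludes the outcomes 0 and 1. If slack 2
vanished, always guessing state 2 would be optimal and `0 ∈ P_I(q)`. -/
lemma IsFrame.slack_ne_zero (F : E.IsFrame ν₁ ν₂ T V) (h : E.Intermediate q)
    (hL : E.IsLagrange q L)
    (hs : ∀ i, Vᴴ * (L - E.wstate q i) * V = E.slack q x y w i ∧ (E.slack q x y w i).PosSemidef)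
    (i : Fin 3) : E.slack q x y w i ≠ 0 := by
  have hdiag : ∀ i, 0 ≤ y + E.shift₂ q i := fun i =>
    (Complex.le_def.mp ((hs i).2.diag_nonneg (i := 1))).1
  have h0 := hdiag 0
  have h2 := hdiag 2
  simp only [shift₂, cons_val_zero, cons_val, add_zero] at h0 h2
  intro hz
  have hz1 : y + E.shift₂ q i = 0 := by
    have := congrFun (congrFun hz 1) 1
    simpa [slack, ← Complex.ofReal_add] using this
  fin_cases i
  · simp [shift₂] at hz1
    linarith [h.lt_C₂]
  · simp [shift₂] at hz1
    linarith [h.lt_C₂, h.half_lt]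
  · have hLW : L - E.wstate q 2 = 0 := by
      rw [← F.conj_cancel (L - E.wstate q 2), (hs 2).1]
      rw [show E.slack q x y w 2 = 0 from hz]; simp
    have hN : IsPOVM ![(0 : QubitOp), 0, 1] :=
      isPOVM_vec PosSemidef.zero PosSemidef.zero PosSemidef.one (by simp)
    refine h.zero_notMem ⟨_, hL.isOptimal hN fun i => ?_, by simp⟩
    fin_cases i <;> simp [hLW]

lemma IsFrame.sum_conj (F : E.IsFrame ν₁ ν₂ T V) {M : Fin 3 → QubitOp} (hM : IsPOVM M) :
    Tᴴ * M 0 * T + Tᴴ * M 1 * T + Tᴴ * M 2 * T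
      = !![E.entry ν₁ ν₁, E.entry ν₁ ν₂; E.entry ν₂ ν₁, E.entry ν₂ ν₂] := by
  rw [← F.gram, ← Matrix.add_mul, ← Matrix.add_mul, ← Matrix.mul_add, ← Matrix.mul_add]
  have := hM.2
  rw [Fin.sum_univ_three] at this
  rw [this, Matrix.mul_one]

lemma IsFrame.slack_mul (F : E.IsFrame ν₁ ν₂ T V) (hL : E.IsLagrange q L)
    (hs : ∀ i, Vᴴ * (L - E.wstate q i) * V = E.slack q x y w i ∧ (E.slack q x y w i).PosSemidef)
    {M : Fin 3 → QubitOp} (hM : E.IsOptimal q M) (i : Fin 3) :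
    E.slack q x y w i * (Tᴴ * M i * T) = 0 := by
  rw [← (hs i).1, F.conj_mul, hL.mul_eq_zero hM i]; simp

/-- If `w = 0`, every slack is diagonal and nonzero, which forces each transformed `Mᵢ` to be
diagonal. Their sum would be diagonal too, but its off-diagonal entry is `ρ₁₂ ≠ 0`. -/
lemma IsFrame.offdiag_ne_zero (F : E.IsFrame ν₁ ν₂ T V) (h : E.Intermediate q)
    (hz : E.entry ν₁ ν₂ ≠ 0) (hL : E.IsLagrange q L)
    (hs : ∀ i, Vᴴ * (L - E.wstate q i) * V = E.slack q x y w i ∧ (E.slack q x y w i).PosSemidef) :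
    w ≠ 0 := by
  rintro rfl
  obtain ⟨M, hM⟩ := E.exists_isOptimal q
  have hoff : ∀ i, (Tᴴ * M i * T) 0 1 = 0 := fun i => by
    have hmul := F.slack_mul hL hs hM i
    have hH : (Tᴴ * M i * T) 1 0 = star ((Tᴴ * M i * T) 0 1) :=
      (((hM.1.1 i).conjTranspose_mul_mul_same T).isHermitian.apply 1 0).symm
    generalize Tᴴ * M i * T = N at hmul hH
    have e1 := congrFun (congrFun hmul 0) 1
    have e2 := congrFun (congrFun hmul 1) 0
    simp only [slack, mul_apply, Fin.sum_univ_two, of_apply, cons_val', cons_val_zero,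
      cons_val_one, cons_val_fin_one, star_zero, zero_mul, add_zero, zero_add, Matrix.zero_apply,
      mul_eq_zero] at e1 e2
    rcases e1 with e1 | e1
    · rcases e2 with e2 | e2
      · refine absurd ?_ (F.slack_ne_zero h hL hs i)
        ext j k
        fin_cases j <;> fin_cases k <;> simp [slack, e1, e2]
      · rw [hH, star_eq_zero] at e2; exact e2
    · exact e1
  have := congrFun (congrFun (F.sum_conj hM.1) 0) 1
  simp only [Matrix.add_apply, hoff, of_apply, cons_val', cons_val_zero, cons_val_one,
    cons_val_fin_one, add_zero] at this
  exact hz this.symm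

lemma IsFrame.exists_coeff (F : E.IsFrame ν₁ ν₂ T V)
    (hw : w ≠ 0) (hL : E.IsLagrange q L)
    (hs : ∀ i, Vᴴ * (L - E.wstate q i) * V = E.slack q x y w i ∧ (E.slack q x y w i).PosSemidef)
    {M : Fin 3 → QubitOp} (hM : E.IsOptimal q M) :
    ∃ m : Fin 3 → ℝ, (∀ i, 0 ≤ m i) ∧ (∀ i, Tᴴ * M i * T = (m i : ℂ) • E.coslack q x y w i) ∧
      (∀ i, M i ≠ 0 → (x + E.shift₁ q i) * (y + E.shift₂ q i) = Complex.normSq w) ∧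
      ((m 0 + m 1 + m 2 : ℝ) : ℂ) * w = -E.entry ν₁ ν₂ ∧
      y * (m 0 + m 1 + m 2) + m 1 * (q - 1 + E.C₂) + m 2 * (q - E.C₂) = (E.entry ν₁ ν₁).re ∧
      x * (m 0 + m 1 + m 2) + m 1 * (q - E.C₁) + m 2 * (q - 1 + E.C₁) = (E.entry ν₂ ν₂).re := by
  have hex : ∀ i, ∃ m : ℝ, 0 ≤ m ∧ Tᴴ * M i * T = (m : ℂ) • E.coslack q x y w i ∧
      (M i ≠ 0 → (x + E.shift₁ q i) * (y + E.shift₂ q i) = Complex.normSq w) := fun i => by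
    obtain ⟨m, hm, h1, h2⟩ := exists_eq_smul_of_mul_eq_zero (hs i).2
      ((hM.1.1 i).conjTranspose_mul_mul_same T) (F.slack_mul hL hs hM i) hw
    refine ⟨m, hm, h1, fun hne => ?_⟩
    have h3 := h2 fun h0 => hne (by rw [← F.conj_cancel' (M i), h0]; simp)
    simp only [slack, of_apply, cons_val', cons_val_zero, cons_val_one, cons_val_fin_one,
      Complex.star_def, Complex.mul_conj] at h3
    exact_mod_cast h3
  choose m hm h1 h2 using hex
  have hsum := F.sum_conj hM.1
  simp only [h1] at hsum
  have s00 := congrArg Complex.re (congrFun (congrFun hsum 0) 0)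
  have s01 := congrFun (congrFun hsum 0) 1
  have s11 := congrArg Complex.re (congrFun (congrFun hsum 1) 1)
  simp only [coslack, shift₁, shift₂, Matrix.add_apply, Matrix.smul_apply, smul_eq_mul, of_apply,
    cons_val', cons_val_zero, cons_val_one, cons_val, cons_val_fin_one, Complex.add_re,
    Complex.re_ofReal_mul, Complex.ofReal_re] at s00 s01 s11
  refine ⟨m, hm, h1, h2, ?_, ?_, ?_⟩
  · rw [← s01]; push_cast; ring
  · rw [← s00]; ring
  · rw [← s11]; ring

end Core

end QubitEnsemble

/-! ### Uniqueness, and the formulas when all outcomes occur. -/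

namespace QubitEnsemble

variable {E : QubitEnsemble} {ν₁ ν₂ : Fin 2 → ℂ} {T V : QubitOp} {q : ℝ}

lemma IsFrame.unique (F : E.IsFrame ν₁ ν₂ T V) (h : E.Intermediate q)
    (hz : E.entry ν₁ ν₂ ≠ 0) (M N : Fin 3 → QubitOp) (hM : E.IsOptimal q M)
    (hN : E.IsOptimal q N) : M = N := by
  obtain ⟨L, hL⟩ := E.exists_isLagrange q
  obtain ⟨x, y, w, hs⟩ := F.exists_slack hL
  have hw := F.offdiag_ne_zero h hz hL hs
  -- The same `x, y, w` serve both POVMs, since they depend only on `L`.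
  obtain ⟨m, -, hm, -, hm0, hm1, hm2⟩ := F.exists_coeff hw hL hs hM
  obtain ⟨n, -, hn, -, hn0, hn1, hn2⟩ := F.exists_coeff hw hL hs hN
  have hsum : m 0 + m 1 + m 2 = n 0 + n 1 + n 2 := by
    exact_mod_cast mul_right_cancel₀ hw (hm0.trans hn0.symm)
  rw [hsum] at hm1 hm2
  have hmn : m = n := system_unique (by linarith [h.half_lt]) (by linarith [h.one_lt]) hsum rfl
    hm1 hn1 hm2 hn2
  funext i
  rw [← F.conj_cancel' (M i), hm i, hmn, ← hn i, F.conj_cancel']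

/-- The off-diagonal entry of the Lagrange operator when all outcomes occur. -/
noncomputable def offdiag (E : QubitEnsemble) (ν₁ ν₂ : Fin 2 → ℂ) (q : ℝ) : ℂ :=
  -(E.entry ν₁ ν₂ * (Real.sqrt (lam₁ q E.C₁ E.C₂ * lam₂ q E.C₁ E.C₂) : ℂ)
    / (‖E.entry ν₁ ν₂‖ : ℂ))

/-- The coefficients of the measurement operators when all outcomes occur. -/
noncomputable def coeff (E : QubitEnsemble) (ν₁ ν₂ : Fin 2 → ℂ) (q : ℝ) : Fin 3 → ℝ :=
  ![coeff₀ q E.C₁ E.C₂ (E.entry ν₁ ν₁).re (E.entry ν₂ ν₂).re ‖E.entry ν₁ ν₂‖,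
    coeff₁ q E.C₁ E.C₂ (E.entry ν₁ ν₁).re (E.entry ν₂ ν₂).re ‖E.entry ν₁ ν₂‖,
    coeff₂ q E.C₁ E.C₂ (E.entry ν₁ ν₁).re (E.entry ν₂ ν₂).re ‖E.entry ν₁ ν₂‖]

lemma norm_offdiag (hz : E.entry ν₁ ν₂ ≠ 0) :
    ‖E.offdiag ν₁ ν₂ q‖ = Real.sqrt (lam₁ q E.C₁ E.C₂ * lam₂ q E.C₁ E.C₂) := by
  have hr : ‖E.entry ν₁ ν₂‖ ≠ 0 := norm_ne_zero_iff.mpr hz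
  rw [offdiag, norm_neg, norm_div, norm_mul, Complex.norm_real, Complex.norm_real, norm_norm,
    Real.norm_of_nonneg (Real.sqrt_nonneg _)]
  field_simp

/-- The measurement with three non-zero outcomes. -/
lemma IsFrame.of_forall_ne_zero (F : E.IsFrame ν₁ ν₂ T V) (h : E.Intermediate q)
    (hz : E.entry ν₁ ν₂ ≠ 0) {M : Fin 3 → QubitOp} (hM : E.IsOptimal q M) (hne : ∀ i, M i ≠ 0) :
    q < E.C₁ ∧ (∀ i, 0 < E.coeff ν₁ ν₂ q i) ∧
    (∀ i, Tᴴ * M i * T = (E.coeff ν₁ ν₂ q i : ℂ) •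
      E.coslack q (lam₁ q E.C₁ E.C₂) (lam₂ q E.C₁ E.C₂) (E.offdiag ν₁ ν₂ q) i) ∧
    E.pbarOpt q = q + (E.entry ν₁ ν₁).re * lam₁ q E.C₁ E.C₂
      + (E.entry ν₂ ν₂).re * lam₂ q E.C₁ E.C₂
      - 2 * ‖E.entry ν₁ ν₂‖ * Real.sqrt (lam₁ q E.C₁ E.C₂ * lam₂ q E.C₁ E.C₂) := by
  have hu : 0 < 2 * q - 1 := by linarith [h.half_lt]
  have hC : 0 < E.C₁ + E.C₂ - 1 := by linarith [h.one_lt]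
  obtain ⟨L, hL⟩ := E.exists_isLagrange q
  obtain ⟨x, y, w, hs⟩ := F.exists_slack hL
  have hw := F.offdiag_ne_zero h hz hL hs
  obtain ⟨m, hmn, hm, hdet, hm0, hm1, hm2⟩ := F.exists_coeff hw hL hs hM
  have d0 := hdet 0 (hne 0)
  have d1 := hdet 1 (hne 1)
  have d2 := hdet 2 (hne 2)
  simp only [shift₁, shift₂, cons_val_zero, cons_val_one, cons_val, add_zero] at d0 d1 d2
  obtain ⟨hx, hy⟩ := eq_lam_of_det hu.ne' hC.ne' d0 d1 d2
  have hnw : 0 < Complex.normSq w := Complex.normSq_pos.mpr hw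
  have hxy : 0 ≤ x ∧ 0 ≤ y := by
    constructor
    · simpa [slack, shift₁] using (Complex.le_def.mp ((hs 0).2.diag_nonneg (i := 0))).1
    · simpa [slack, shift₂] using (Complex.le_def.mp ((hs 0).2.diag_nonneg (i := 1))).1
  have hx0 : 0 < x := lt_of_le_of_ne hxy.1 fun h0 => by rw [← h0, zero_mul] at d0; linarith
  have hy0 : 0 < y := lt_of_le_of_ne hxy.2 fun h0 => by rw [← h0, mul_zero] at d0; linarith
  have hpos : ∀ i, 0 < m i := fun i => lt_of_le_of_ne (hmn i) fun h0 => hne i <| by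
    rw [← F.conj_cancel' (M i), hm i, ← h0]; simp
  set t := m 0 + m 1 + m 2 with ht
  have ht0 : 0 < t := by linarith [hpos 0, hpos 1, hpos 2]
  have hnorm : ‖w‖ = Real.sqrt (x * y) := by
    rw [d0, Complex.norm_def]
  have hs0 : 0 < Real.sqrt (x * y) := Real.sqrt_pos.mpr (mul_pos hx0 hy0)
  have hr : t * Real.sqrt (x * y) = ‖E.entry ν₁ ν₂‖ := by
    rw [← hnorm, ← norm_neg (E.entry ν₁ ν₂), ← hm0, norm_mul, Complex.norm_real,
      Real.norm_of_nonneg ht0.le]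
  have hr0 : ‖E.entry ν₁ ν₂‖ ≠ 0 := norm_ne_zero_iff.mpr hz
  -- `t w = -ρ₁₂` with `t > 0` fixes the phase of `w`, and the vanishing determinant fixes its
  -- modulus.
  have hwo : w = E.offdiag ν₁ ν₂ q := by
    have hr0' : (‖E.entry ν₁ ν₂‖ : ℂ) ≠ 0 := by exact_mod_cast hr0
    rw [offdiag, ← hx, ← hy, ← neg_div, ← neg_mul, ← hm0, eq_div_iff hr0', ← hr]
    push_cast; ring
  have hts : t = ‖E.entry ν₁ ν₂‖ / Real.sqrt (x * y) := by rw [← hr]; field_simp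
  obtain ⟨c0, c1, c2⟩ := coeff_system (r := ‖E.entry ν₁ ν₂‖) (s := Real.sqrt (x * y)) hs0.ne'
    hu.ne' hC.ne' (by rw [hx, hy]; exact sqrt_lam_mul hu hC) F.entry_add
  have hmc : m = E.coeff ν₁ ν₂ q := by
    refine system_unique hu.ne' hC.ne' hts c0 ?_ c1 ?_ c2
    · rw [← hm1, ← hts, hy]
    · rw [← hm2, ← hts, hx]
  refine ⟨?_, hmc ▸ hpos, ?_, ?_⟩
  · refine lt_C₁_of_lam_pos hu hC h.lt_C₂ (hx ▸ hx0) (hy ▸ hy0)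
  · rw [← hmc, ← hx, ← hy, ← hwo]; exact hm
  -- The optimum is `tr L = q + tr[L - qρ₀]`. In the frame the last trace pairs slack 0 with the
  -- Gram matrix, and each cross term contributes `-|ρ₁₂|√(λ₁λ₂)`.
  · have htr := F.trace_conj (L - E.wstate q 0) 1
    rw [(hs 0).1, Matrix.mul_one, Matrix.mul_one, F.gram, trace_sub] at htr
    have htr2 := congrArg Complex.re htr
    rw [Complex.sub_re, E.wstate_trace q 0, ← hL.2] at htr2
    have hw0 : E.weight q 0 = q := rfl
    have hwz : (w * E.entry ν₂ ν₁).re = -(‖E.entry ν₁ ν₂‖ * Real.sqrt (x * y)) := by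
      have e : w * E.entry ν₂ ν₁ = -((t * Complex.normSq w : ℝ) : ℂ) := by
        have hz' : E.entry ν₁ ν₂ = -((t : ℂ) * w) := by rw [hm0, neg_neg]
        rw [← entry_star, hz', star_neg, star_mul', Complex.ofReal_mul, ← Complex.mul_conj,
          Complex.star_def, Complex.conj_ofReal]
        ring
      rw [e, ← hr, ← d0, Complex.neg_re, Complex.ofReal_re, mul_assoc,
        Real.mul_self_sqrt (mul_pos hx0 hy0).le]
    have hwz2 : (star w * E.entry ν₁ ν₂).re = -(‖E.entry ν₁ ν₂‖ * Real.sqrt (x * y)) := by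
      rw [← hwz, ← entry_star E ν₂ ν₁, ← star_mul', Complex.star_def, Complex.conj_re]
    simp only [trace_fin_two, mul_apply, Fin.sum_univ_two, slack, shift₁, shift₂, of_apply,
      cons_val', cons_val_zero, cons_val_one, cons_val_fin_one, Complex.add_re,
      Complex.re_ofReal_mul, hwz, hwz2, add_zero] at htr2
    rw [← hx, ← hy]
    linarith

end QubitEnsemble

/-! ### Construction of an optimal POVM with three nonzero outcomes. -/

namespace QubitEnsemble

variable {E : QubitEnsemble} {ν₁ ν₂ : Fin 2 → ℂ} {T V : QubitOp} {q : ℝ}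

lemma slack_posSemidef {x y : ℝ} {w : ℂ} {i : Fin 3}
    (ht : 0 < x + E.shift₁ q i + (y + E.shift₂ q i))
    (hd : (x + E.shift₁ q i) * (y + E.shift₂ q i) = Complex.normSq w) :
    (E.slack q x y w i).PosSemidef := posSemidef_of_det_eq_zero ht hd

lemma coslack_posSemidef {x y : ℝ} {w : ℂ} {i : Fin 3}
    (ht : 0 < x + E.shift₁ q i + (y + E.shift₂ q i))
    (hd : (x + E.shift₁ q i) * (y + E.shift₂ q i) = Complex.normSq w) :
    (E.coslack q x y w i).PosSemidef := by
  have := posSemidef_of_det_eq_zero (x := y + E.shift₂ q i) (y := x + E.shift₁ q i) (w := -w)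
    (by linarith) (by rw [Complex.normSq_neg, ← hd, mul_comm])
  rwa [star_neg] at this

lemma slack_mul_coslack {x y : ℝ} {w : ℂ} {i : Fin 3}
    (hd : (x + E.shift₁ q i) * (y + E.shift₂ q i) = Complex.normSq w) :
    E.slack q x y w i * E.coslack q x y w i = 0 := by
  have hc : ((x + E.shift₁ q i : ℝ) : ℂ) * ((y + E.shift₂ q i : ℝ) : ℂ) = w * star w := by
    rw [Complex.star_def, Complex.mul_conj, ← hd]; push_cast; rfl
  rw [slack, coslack, mul_fin_two]
  generalize ((x + E.shift₁ q i : ℝ) : ℂ) = a at hc ⊢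
  generalize ((y + E.shift₂ q i : ℝ) : ℂ) = b at hc ⊢
  ext j k
  fin_cases j <;> fin_cases k <;> simp
  · rw [hc]; simp
  · ring
  · ring
  · rw [mul_comm b a, hc, Complex.star_def]; ring

/-- The POVM built from positive coefficients is optimal and has three non-zero outcomes. -/
lemma IsFrame.exists_isOptimal_ne_zero (F : E.IsFrame ν₁ ν₂ T V) (h : E.Intermediate q)
    (hz : E.entry ν₁ ν₂ ≠ 0) (hq : q < E.C₁) (hc : ∀ i, 0 < E.coeff ν₁ ν₂ q i) :
    ∃ M, E.IsOptimal q M ∧ ∀ i, M i ≠ 0 := by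
  have hu : 0 < 2 * q - 1 := by linarith [h.half_lt]
  have hC : 0 < E.C₁ + E.C₂ - 1 := by linarith [h.one_lt]
  obtain ⟨hx, hy⟩ := lam_pos hu hq h.lt_C₂
  obtain ⟨t1, t2⟩ := lam_trace_pos hu hq h.lt_C₂ h.le_C₂
  obtain ⟨d1, d2⟩ := lam_det (q := q) (C₁ := E.C₁) (C₂ := E.C₂) hu.ne' hC.ne'
  have hs0 := Real.sqrt_pos.mpr (mul_pos hx hy)
  obtain ⟨c0, c1, c2⟩ := coeff_system (r := ‖E.entry ν₁ ν₂‖) hs0.ne' hu.ne' hC.ne'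
    (sqrt_lam_mul hu hC) F.entry_add
  have hnw := norm_offdiag (q := q) hz
  have hr0 : (‖E.entry ν₁ ν₂‖ : ℂ) ≠ 0 := by exact_mod_cast norm_ne_zero_iff.mpr hz
  have hwr : (((‖E.entry ν₁ ν₂‖ / Real.sqrt (lam₁ q E.C₁ E.C₂ * lam₂ q E.C₁ E.C₂) : ℝ)) : ℂ)
      * E.offdiag ν₁ ν₂ q = -E.entry ν₁ ν₂ := by
    have : (Real.sqrt (lam₁ q E.C₁ E.C₂ * lam₂ q E.C₁ E.C₂) : ℂ) ≠ 0 := by exact_mod_cast hs0.ne'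
    rw [offdiag]; push_cast; field_simp
  have hnsq : lam₁ q E.C₁ E.C₂ * lam₂ q E.C₁ E.C₂ = Complex.normSq (E.offdiag ν₁ ν₂ q) := by
    rw [Complex.normSq_eq_norm_sq, hnw, Real.sq_sqrt (mul_pos hx hy).le]
  have hw : E.offdiag ν₁ ν₂ q ≠ 0 := norm_ne_zero_iff.mp (hnw ▸ hs0.ne')
  generalize E.offdiag ν₁ ν₂ q = w at hnw hwr hnsq hw
  -- From here only the sign, determinant and completeness relations matter, not the explicit
  -- formulas.
  generalize lam₁ q E.C₁ E.C₂ = x at *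
  generalize lam₂ q E.C₁ E.C₂ = y at *
  have hm0 : E.coeff ν₁ ν₂ q 0 + E.coeff ν₁ ν₂ q 1 + E.coeff ν₁ ν₂ q 2
      = ‖E.entry ν₁ ν₂‖ / Real.sqrt (x * y) := c0
  have hm1 : y * (‖E.entry ν₁ ν₂‖ / Real.sqrt (x * y)) + E.coeff ν₁ ν₂ q 1 * (q - 1 + E.C₂)
      + E.coeff ν₁ ν₂ q 2 * (q - E.C₂) = (E.entry ν₁ ν₁).re := c1
  have hm2 : x * (‖E.entry ν₁ ν₂‖ / Real.sqrt (x * y)) + E.coeff ν₁ ν₂ q 1 * (q - E.C₁)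
      + E.coeff ν₁ ν₂ q 2 * (q - 1 + E.C₁) = (E.entry ν₂ ν₂).re := c2
  rw [← hm0] at hwr hm1 hm2
  generalize E.coeff ν₁ ν₂ q = m at *
  have htr : ∀ i, 0 < x + E.shift₁ q i + (y + E.shift₂ q i) := fun i => by
    fin_cases i <;> simp [shift₁, shift₂] <;> linarith
  have hdet : ∀ i, (x + E.shift₁ q i) * (y + E.shift₂ q i) = Complex.normSq w := fun i => by
    rw [← hnsq]
    fin_cases i <;> simp [shift₁, shift₂, d1, d2]
  set L : QubitOp := T * (E.slack q x y w 0 + (q : ℂ) • 1) * Tᴴ with hL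
  have hLW : ∀ i, L - E.wstate q i = T * E.slack q x y w i * Tᴴ := fun i => by
    rw [← F.conj_cancel (E.wstate q i), F.conj_wstate, hL, ← Matrix.sub_mul, ← Matrix.mul_sub]
    congr 2
    ext j k
    fin_cases j <;> fin_cases k <;> simp [slack, shift₁, shift₂] <;> ring
  have hLpsd : ∀ i, (L - E.wstate q i).PosSemidef := fun i => by
    rw [hLW]
    exact (slack_posSemidef (htr i) (hdet i)).mul_mul_conjTranspose_same T
  let M : Fin 3 → QubitOp := fun i => V * ((m i : ℂ) • E.coslack q x y w i) * Vᴴ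
  have hsum : (m 0 : ℂ) • E.coslack q x y w 0 + (m 1 : ℂ) • E.coslack q x y w 1
      + (m 2 : ℂ) • E.coslack q x y w 2 = Tᴴ * T := by
    have hwr' := congrArg star hwr
    rw [star_neg, entry_star, star_mul', Complex.star_def, Complex.conj_ofReal] at hwr'
    have k1 := congrArg (fun r : ℝ => (r : ℂ)) hm1
    have k2 := congrArg (fun r : ℝ => (r : ℂ)) hm2
    simp only [← (entry_self E _).1] at k1 k2
    push_cast at hwr hwr' k1 k2
    rw [F.gram]
    ext j k
    fin_cases j <;> fin_cases k <;> simp [coslack, shift₁, shift₂]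
    · linear_combination k1
    · linear_combination -hwr
    · linear_combination -hwr'
    · linear_combination k2
  have hM : IsPOVM M := by
    refine ⟨fun i => ?_, ?_⟩
    · exact ((coslack_posSemidef (htr i) (hdet i)).smul
        (Complex.zero_le_real.mpr (hc i).le)).mul_mul_conjTranspose_same V
    · rw [Fin.sum_univ_three]
      change V * _ * Vᴴ + V * _ * Vᴴ + V * _ * Vᴴ = 1
      rw [← Matrix.add_mul, ← Matrix.add_mul, ← Matrix.mul_add, ← Matrix.mul_add, hsum]
      simpa using F.conj_cancel' 1
  have hzero : ∀ i, (L - E.wstate q i) * M i = 0 := fun i => by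
    rw [hLW]
    calc T * E.slack q x y w i * Tᴴ * (V * ((m i : ℂ) • E.coslack q x y w i) * Vᴴ)
        = T * (E.slack q x y w i * (Tᴴ * V) * ((m i : ℂ) • E.coslack q x y w i)) * Vᴴ := by
          simp only [Matrix.mul_assoc]
      _ = 0 := by
          rw [F.mul₂, Matrix.mul_one, mul_smul_comm, slack_mul_coslack (hdet i)]; simp
  refine ⟨M, (isLagrange_of_psd hLpsd hM hzero).isOptimal hM hzero, fun i h0 => ?_⟩
  have h1 : Tᴴ * M i * T = (m i : ℂ) • E.coslack q x y w i := by
    calc Tᴴ * (V * ((m i : ℂ) • E.coslack q x y w i) * Vᴴ) * T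
        = (Tᴴ * V) * ((m i : ℂ) • E.coslack q x y w i) * (Vᴴ * T) := by
          simp only [Matrix.mul_assoc]
      _ = _ := by rw [F.mul₂, F.mul₄, Matrix.one_mul, Matrix.mul_one]
  rw [h0] at h1
  -- The off-diagonal entry of the transformed operator is `-mᵢ w`, with both factors nonzero.
  have h2 := congrFun (congrFun h1 0) 1
  simp [coslack, hw, (hc i).ne'] at h2

/-- The trace of `ρ₀ M` in the eigenbasis. -/
lemma IsFrame.trace_ρ₀_mul (F : E.IsFrame ν₁ ν₂ T V) (M : QubitOp) :
    (E.ρ₀ * M).trace = (Tᴴ * M * T).trace := by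
  rw [← F.trace_conj, F.conj_zero, Matrix.one_mul]

end QubitEnsemble

/-! ### Assembly of the theorem. -/

theorem mainTheorem3 (E : QubitEnsemble) (hC : E.C₁ ≤ E.C₂) (ν₁ ν₂ : Fin 2 → ℂ)
    (hν₁ : IsUnitEigenvector E.barState₁ E.C₁ ν₁)
    (hν₂ : IsUnitEigenvector E.barState₂ E.C₂ ν₂)
    (hρ : E.entry ν₁ ν₂ ≠ 0)
    (q : ℝ) (hq₀ : E.qLow < q) (hq₁ : q < E.qHigh)
    (C₁ C₂ ρ₁₁ ρ₂₂ l₁ l₂ η₀ η₁ η₂ : ℝ) (ρ₁₂ ρ₂₁ : ℂ)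
    (hC₁ : C₁ = E.C₁) (hC₂ : C₂ = E.C₂)
    (hρ₁₁ : ρ₁₁ = (E.entry ν₁ ν₁).re) (hρ₂₂ : ρ₂₂ = (E.entry ν₂ ν₂).re)
    (hρ₁₂ : ρ₁₂ = E.entry ν₁ ν₂) (hρ₂₁ : ρ₂₁ = E.entry ν₂ ν₁)
    (hl₁ : l₁ = lam₁ q C₁ C₂) (hl₂ : l₂ = lam₂ q C₁ C₂)
    (hη₀ : η₀ = eta₀ q C₁ C₂ ρ₁₁ ρ₂₂ ‖ρ₁₂‖)
    (hη₁ : η₁ = eta₁ q C₁ C₂ ρ₁₁ ρ₂₂ ‖ρ₁₂‖)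
    (hη₂ : η₂ = eta₂ q C₁ C₂ ρ₁₁ ρ₂₂ ‖ρ₁₂‖) :
    (∃! M : Fin 3 → QubitOp, E.IsOptimal q M) ∧
    ∀ M : Fin 3 → QubitOp, E.IsOptimal q M →
      (M 1 ≠ 0 ∨ M 2 ≠ 0) ∧
      (∀ x y : Fin 3, (x = 1 ∧ y = 2) ∨ (x = 2 ∧ y = 1) → M x ≠ 0 → M y = 0 →
        E.weight q y + ‖E.blochDiff q y‖ < E.weight q x + ‖E.blochDiff q x‖ ∧
        E.pbarOpt q = 1 / 2 * (q + E.weight q x + ‖E.blochDiff q x‖) ∧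
        E.PI q = {1 / 2 * (1 + inner ℝ (E.blochDiff q x) (bloch E.ρ₀) / ‖E.blochDiff q x‖)} ∧
        M 0 = (1 / 2 : ℂ) • (1 + dotPauli (‖E.blochDiff q x‖⁻¹ • E.blochDiff q x)) ∧
        M x = (1 / 2 : ℂ) • (1 + dotPauli (‖E.blochDiff q x‖⁻¹ • (-E.blochDiff q x)))) ∧
      ((∀ i, M i ≠ 0) →
        E.pbarOpt q = q + ρ₁₁ * l₁ + ρ₂₂ * l₂ - 2 * ‖ρ₁₂‖ * Real.sqrt (l₁ * l₂) ∧
        E.PI q = {η₀} ∧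
        E.bar (M 0) = opInBasis ν₁ ν₂ (η₀ / (l₁ + l₂))
          l₂
          (ρ₁₂ * (Real.sqrt (l₁ * l₂) : ℂ) / (‖ρ₁₂‖ : ℂ))
          (ρ₂₁ * (Real.sqrt (l₁ * l₂) : ℂ) / (‖ρ₂₁‖ : ℂ))
          l₁ ∧
        E.bar (M 1) = opInBasis ν₁ ν₂ (η₁ / (l₁ + l₂ + 2 * q - 1 - C₁ + C₂))
          (l₂ + q - 1 + C₂)
          (ρ₁₂ * (Real.sqrt (l₁ * l₂) : ℂ) / (‖ρ₁₂‖ : ℂ))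
          (ρ₂₁ * (Real.sqrt (l₁ * l₂) : ℂ) / (‖ρ₂₁‖ : ℂ))
          (l₁ + q - C₁) ∧
        E.bar (M 2) = opInBasis ν₁ ν₂ (η₂ / (l₁ + l₂ + 2 * q - 1 + C₁ - C₂))
          (l₂ + q - C₂)
          (ρ₁₂ * (Real.sqrt (l₁ * l₂) : ℂ) / (‖ρ₁₂‖ : ℂ))
          (ρ₂₁ * (Real.sqrt (l₁ * l₂) : ℂ) / (‖ρ₂₁‖ : ℂ))
          (l₁ + q - 1 + C₁)) ∧
      (0 ≤ l₁ ∧ 0 ≤ l₂ ∧ 0 < η₀ ∧ 0 < η₁ ∧ 0 < η₂ → ∀ i, M i ≠ 0) ∧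
      (¬ (0 ≤ l₁ ∧ 0 ≤ l₂ ∧ 0 < η₀ ∧ 0 < η₁ ∧ 0 < η₂) → M 1 = 0 ∨ M 2 = 0) := by
  subst hC₁ hC₂ hρ₁₁ hρ₂₂ hρ₁₂ hρ₂₁ hl₁ hl₂ hη₀ hη₁ hη₂
  have h := QubitEnsemble.intermediate_of_lt hC hq₀ hq₁
  have hu : 0 < 2 * q - 1 := by linarith [h.half_lt]
  have hCC : 0 < E.C₁ + E.C₂ - 1 := by linarith [h.one_lt]
  obtain ⟨T, V, F⟩ := QubitEnsemble.exists_isFrame h.one_lt hν₁ hν₂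
  have huniq := F.unique h hρ
  have h1 : (1 : ℝ) ∉ E.PI q := fun hm =>
    not_le.mpr hq₁ (QubitEnsemble.le_of_one_mem_PI (by linarith [h.half_lt]) hm)
  have hM0 : ∀ M, E.IsOptimal q M → M 0 ≠ 0 := fun M hM h0 =>
    h.zero_notMem ⟨M, hM, by simp [h0]⟩
  have e₀ := eta₀_eq (q := q) (a := (E.entry ν₁ ν₁).re) (b := (E.entry ν₂ ν₂).re)
    (r := ‖E.entry ν₁ ν₂‖) hu.ne' hCC.ne'
  have e₁ := eta₁_eq (q := q) (a := (E.entry ν₁ ν₁).re) (b := (E.entry ν₂ ν₂).re)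
    (r := ‖E.entry ν₁ ν₂‖) hu.ne' hCC.ne'
  have e₂ := eta₂_eq (q := q) (a := (E.entry ν₁ ν₁).re) (b := (E.entry ν₂ ν₂).re)
    (r := ‖E.entry ν₁ ν₂‖) hu.ne' hCC.ne'
  -- Each `ηᵢ` becomes a coefficient times a trace, so the prefactors of the operators and the signs
  -- of the `ηᵢ` both reduce to the coefficients.
  rw [e₀, e₁, e₂]
  refine ⟨?_, fun M hM => ⟨?_, fun x y hxy _ hy =>
    QubitEnsemble.optimal_of_eq_zero huniq h.zero_notMem h1 hM x y hxy hy, ?_, ?_, ?_⟩⟩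
  · obtain ⟨M, hM⟩ := E.exists_isOptimal q
    exact ⟨M, hM, fun N hN => huniq N M hN hM⟩
  -- If `M₁ = M₂ = 0` then `M₀ = I`, and `1 ∈ P_I(q)`.
  · by_contra! hcon
    refine h1 ⟨M, hM, ?_⟩
    have hs := hM.1.2
    rw [Fin.sum_univ_three, hcon.1, hcon.2, add_zero, add_zero] at hs
    rw [hs, mul_one, E.ρ₀_trace, Complex.one_re]
  · intro hne
    obtain ⟨hq, -, hM', hopt⟩ := F.of_forall_ne_zero h hρ hM hne
    obtain ⟨p1, p2⟩ := lam_pos hu hq h.lt_C₂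
    obtain ⟨t1, t2⟩ := lam_trace_pos hu hq h.lt_C₂ h.le_C₂
    have hnorm : ‖E.entry ν₂ ν₁‖ = ‖E.entry ν₁ ν₂‖ := by
      rw [← QubitEnsemble.entry_star, norm_star]
    have hoff : -star (E.offdiag ν₁ ν₂ q) = E.entry ν₂ ν₁
        * (Real.sqrt (lam₁ q E.C₁ E.C₂ * lam₂ q E.C₁ E.C₂) : ℂ) / (‖E.entry ν₁ ν₂‖ : ℂ) := by
      rw [QubitEnsemble.offdiag, star_neg, neg_neg, ← QubitEnsemble.entry_star E ν₁ ν₂]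
      simp only [Complex.star_def, map_div₀, map_mul, Complex.conj_ofReal]
    refine ⟨hopt, ?_, ?_, ?_, ?_⟩
    · have htr : ((E.ρ₀ * M 0).trace).re = coeff₀ q E.C₁ E.C₂ (E.entry ν₁ ν₁).re
          (E.entry ν₂ ν₂).re ‖E.entry ν₁ ν₂‖ * (lam₁ q E.C₁ E.C₂ + lam₂ q E.C₁ E.C₂) := by
        rw [F.trace_ρ₀_mul, hM' 0, trace_smul, smul_eq_mul, Complex.re_ofReal_mul]
        simp [QubitEnsemble.coslack, QubitEnsemble.coeff, QubitEnsemble.shift₁,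
          QubitEnsemble.shift₂, trace_fin_two, add_comm]
      ext Q
      refine ⟨?_, fun hQ => ⟨M, hM, htr.trans hQ.symm⟩⟩
      rintro ⟨N, hN, rfl⟩
      rw [huniq N M hN hM]
      exact htr
    all_goals
      apply F.bar
      rw [hM', hnorm, ← hoff, QubitEnsemble.coslack]
    · rw [mul_div_cancel_right₀ _ (by linarith)]
      congr 1
      ext j k
      fin_cases j <;> fin_cases k <;> simp [QubitEnsemble.shift₁, QubitEnsemble.shift₂,
        QubitEnsemble.offdiag]
    · rw [mul_div_cancel_right₀ _ (by linarith)]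
      congr 1
      ext j k
      fin_cases j <;> fin_cases k <;> simp [QubitEnsemble.shift₁, QubitEnsemble.shift₂,
        QubitEnsemble.offdiag] <;> ring
    · rw [mul_div_cancel_right₀ _ (by linarith)]
      congr 1
      ext j k
      fin_cases j <;> fin_cases k <;> simp [QubitEnsemble.shift₁, QubitEnsemble.shift₂,
        QubitEnsemble.offdiag] <;> ring
  · rintro ⟨p1, p2, n0, n1, n2⟩
    have hq : q < E.C₁ := lt_C₁_of_eta₀_pos hu hCC h.lt_C₂ (E.entry_self ν₂).2 F.entry_add p1 p2
      (e₀.symm ▸ n0)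
    obtain ⟨p1', p2'⟩ := lam_pos hu hq h.lt_C₂
    obtain ⟨t1, t2⟩ := lam_trace_pos hu hq h.lt_C₂ h.le_C₂
    obtain ⟨N, hN, hne⟩ := F.exists_isOptimal_ne_zero h hρ hq fun i => by
      fin_cases i
      · exact pos_of_mul_pos_left n0 (by linarith)
      · exact pos_of_mul_pos_left n1 t1.le
      · exact pos_of_mul_pos_left n2 t2.le
    rw [huniq M N hM hN]
    exact hne
  -- `M₀` never vanishes here, so `M₁, M₂ ≠ 0` means that all three outcomes occur; then the
  -- coefficients and the traces are positive.
  · contrapose!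
    rintro ⟨hm1, hm2⟩
    obtain ⟨hq, hc, -, -⟩ := F.of_forall_ne_zero h hρ hM fun i => by
      fin_cases i
      exacts [hM0 M hM, hm1, hm2]
    obtain ⟨p1, p2⟩ := lam_pos hu hq h.lt_C₂
    obtain ⟨t1, t2⟩ := lam_trace_pos hu hq h.lt_C₂ h.le_C₂
    exact ⟨p1.le, p2.le, mul_pos (hc 0) (by linarith), mul_pos (hc 1) t1, mul_pos (hc 2) t2⟩
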